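/- Upper half-space model: $\mathbb{H}^3=\{(\zeta,w)\in\mathbb{C}\times\mathbb{R}: w>0\}$, with metric $(|d\zeta|^2+dw^2)/w^2$, oriented by $(\operatorname{Re}\zeta,\operatorname{Im}\zeta,w)$, with asymptotic boundary $\bar{\mathbb{C}}=\mathbb{C}\cup\{\infty\}$. Let $\Omega\subset\mathbb{C}$ be an open neighbourhood of $0$ and $\Omega^*=\Omega\setminus\{0\}$. A Bryant surface end $E$ with Bryant representation $F=\begin{pmatrix}A&B\\C&D\end{pmatrix}$ is an immersion $X=(\zeta,w):\Omega^*\to\mathbb{H}^3$ given by $$\zeta=\frac{\bar A C+\bar B D}{|A|^2+|B|^2},\qquad w=\frac1{|A|^2+|B|^2},$$ where $A,B,C,D$ are possibly multivalued holomorphic functions on $\Omega^*$, that is, holomorphic functions of $s=\log z$ on $\{s\in\mathbb{C}: e^s\in\Omega\}$, such that $AD-BC=1$ and $dA\,dD-dB\,dC=0$, and such that $X$ is single-valued on $\Omega^*$. (Such an $X$ is conformal of mean curvature one.) Let $\mathcal{C}\neq\mathcal{D}$ in $\bar{\mathbb{C}}$. The Killing field $Y$ associated to the translation along the oriented geodesic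 from $\mathcal{C}$ to $\mathcal{D}$ is defined by $\frac{d\Phi_t}{dt}=Y(\Phi_t)$, where $\Phi_t$ is the translation of distance $t$ along this geodesic. The flux of $Y$ through $E$ is $$\varphi=\int_\Gamma\langle\eta,Y\rangle-2\int_K\langle\nu,Y\rangle .$$ Here $\Gamma=X\circ\gamma$, where $\gamma$ is a regular closed $C^2$ curve in $\Omega^*$, freely homotopic in $\Omega^*$ to a circle $\{|z|=\rho\}$, with $\{|z|\le\rho\}\subset\Omega$, run through once in one of its two directions. The vector $\eta$ is the unit conormal to $\Gamma$ in the direction of the puncture: it is the image under $dX$ of a vector on the left of $\gamma$ if $\gamma$ winds counterclockwise around $0$, and on the right if it winds clockwise. The curve $\Gamma$ is oriented so that $(\Gamma,\eta,-\vec H)$ is direct, where $\vec H$ is the mean curvature vector of $X$. Finally, $K$ is a $C^2$ map of the closed unit disk into $\mathbb{H}^3$ with boundary $\Gamma$, and $\nu$ is the unit normal to $K$ that induces on $\Gamma$ its orientation. Theorem. The one-forms $D\,dC-C\,dD$, $C\,dB-D\,dA$ and $B\,dA-A\,dB$ are single-valued and holomorphic on $\Omega^*$. Put $$\varphi_0=4\pi\operatorname{Res}_0(D\,dC-C\,dD),\quad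 \varphi_1=4\pi\operatorname{Res}_0(C\,dB-D\,dA),\quad \varphi_2=4\pi\operatorname{Res}_0(B\,dA-A\,dB).$$ Then for all distinct $\mathcal{C},\mathcal{D}\in\bar{\mathbb{C}}$ the flux through $E$ of the Killing field associated to the translation along the geodesic from $\mathcal{C}$ to $\mathcal{D}$ is well defined (admissible $\Gamma$ and $K$ exist, and $\varphi$ does not depend on the choice), and $$\varphi=\operatorname{Re}\left(\frac{\varphi_2\mathcal{C}\mathcal{D}+\varphi_1(\mathcal{C}+\mathcal{D})+\varphi_0}{\mathcal{C}-\mathcal{D}}\right),$$ where the quotient means its limit $\varphi_2\mathcal{D}+\varphi_1$ if $\mathcal{C}=\infty$, and $-(\varphi_2\mathcal{C}+\varphi_1)$ if $\mathcal{D}=\infty$. -/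

import Mathlib

open Set Filter Topology MeasureTheory

noncomputable section

namespace BryantFlux

/-! ### The upper half-space model

Points of hyperbolic space are the pairs `(ζ, w) : ℂ × ℝ` with `0 < w`, and tangent vectors are
pairs `(α, β) : ℂ × ℝ`.  The space is oriented by the coordinates `(u, v, w)`, `ζ = u + i v`. -/

/-- Hyperbolic three-space as a subset of `ℂ × ℝ`. -/
def halfSpace : Set (ℂ × ℝ) := {p | 0 < p.2}

/-- The hyperbolic metric `⟨U, V⟩ = (Re (conj α₁ * α₂) + β₁ β₂) / w²` at the point `p`. -/
def hypInner (p U V : ℂ × ℝ) : ℝ :=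
  ((starRingEnd ℂ U.1 * V.1).re + U.2 * V.2) / p.2 ^ 2

/-- The hyperbolic norm of a tangent vector at `p`. -/
def hypNorm (p U : ℂ × ℝ) : ℝ := Real.sqrt (hypInner p U U)

/-- The volume form `w⁻³ du ∧ dv ∧ dw`. -/
def hypVol (p U V W : ℂ × ℝ) : ℝ :=
  Matrix.det !![U.1.re, U.1.im, U.2; V.1.re, V.1.im, V.2; W.1.re, W.1.im, W.2] / p.2 ^ 3

/-- The vector product of the oriented Euclidean space `T_p ℍ³`; it is characterised by
`hypInner_hypCross` below. -/
def hypCross (p U V : ℂ × ℝ) : ℂ × ℝ :=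
  (⟨(U.1.im * V.2 - U.2 * V.1.im) / p.2, (U.2 * V.1.re - U.1.re * V.2) / p.2⟩,
    (U.1.re * V.1.im - U.1.im * V.1.re) / p.2)

theorem hypInner_hypCross (p U V W : ℂ × ℝ) (hp : p ∈ halfSpace) :
    hypInner p (hypCross p U V) W = hypVol p U V W := by
  have hw : p.2 ≠ 0 := ne_of_gt hp
  simp only [hypInner, hypCross, hypVol, Matrix.det_fin_three]
  simp
  field_simp
  ring

/-- The Christoffel part of the Levi-Civita connection of the half-space metric:
`∇_U V = D_U V + christoffel p U V`. -/
def christoffel (p U V : ℂ × ℝ) : ℂ × ℝ :=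
  (-p.2⁻¹) • (U.2 • V + V.2 • U - ((0 : ℂ), (starRingEnd ℂ U.1 * V.1).re + U.2 * V.2))

/-! ### Mean curvature of an immersed surface `X : U ⊆ ℂ → ℍ³` -/

/-- The covariant derivative in the direction `a` of the vector field `dX(b)` along `X`. -/
def covDeriv (X : ℂ → ℂ × ℝ) (z a b : ℂ) : ℂ × ℝ :=
  fderiv ℝ (fun y => fderiv ℝ X y b) z a + christoffel (X z) (fderiv ℝ X z a) (fderiv ℝ X z b)

/-- The unit normal `(X_x × X_y) / ‖X_x × X_y‖`. -/
def unitNormal (X : ℂ → ℂ × ℝ) (z : ℂ) : ℂ × ℝ :=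
  (hypNorm (X z) (hypCross (X z) (fderiv ℝ X z 1) (fderiv ℝ X z Complex.I)))⁻¹ •
    hypCross (X z) (fderiv ℝ X z 1) (fderiv ℝ X z Complex.I)

/-- The coefficient `⟨dX(a), dX(b)⟩` of the first fundamental form. -/
def firstForm (X : ℂ → ℂ × ℝ) (z a b : ℂ) : ℝ :=
  hypInner (X z) (fderiv ℝ X z a) (fderiv ℝ X z b)

/-- The coefficient `⟨∇_a dX(b), n⟩` of the second fundamental form. -/
def secondForm (X : ℂ → ℂ × ℝ) (z a b : ℂ) : ℝ :=
  hypInner (X z) (covDeriv X z a b) (unitNormal X z)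

/-- The mean curvature with respect to `unitNormal X`: half the trace of the second fundamental
form with respect to the first one. -/
def meanCurvature (X : ℂ → ℂ × ℝ) (z : ℂ) : ℝ :=
  (firstForm X z Complex.I Complex.I * secondForm X z 1 1
      - 2 * firstForm X z 1 Complex.I * secondForm X z 1 Complex.I
      + firstForm X z 1 1 * secondForm X z Complex.I Complex.I) /
    (2 * (firstForm X z 1 1 * firstForm X z Complex.I Complex.I - firstForm X z 1 Complex.I ^ 2))

/-- The mean curvature vector. -/
def meanCurvatureVector (X : ℂ → ℂ × ℝ) (z : ℂ) : ℂ × ℝ := meanCurvature X z • unitNormal X z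

/-! ### Bryant surface ends -/

/-- The point of the half-space attached to a matrix `F = (A B; C D)`, namely
`ζ = (conj A * C + conj B * D) / (|A|² + |B|²)` and `w = 1 / (|A|² + |B|²)`. -/
def halfSpacePoint (F : Matrix (Fin 2) (Fin 2) ℂ) : ℂ × ℝ :=
  ((starRingEnd ℂ (F 0 0) * F 1 0 + starRingEnd ℂ (F 0 1) * F 1 1) /
      ((‖F 0 0‖ ^ 2 + ‖F 0 1‖ ^ 2 : ℝ) : ℂ),
    1 / (‖F 0 0‖ ^ 2 + ‖F 0 1‖ ^ 2))

/-- `X : Ω \ {0} → ℍ³` is a Bryant surface end with Bryant representation `F`.  As `F` is in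
general multivalued on `Ω \ {0}`, it is a function of the logarithmic coordinate `s`, `z = exp s`,
which runs through the covering `{s | exp s ∈ Ω}` of `Ω \ {0}` (the universal one if `Ω` is simply
connected), and derivatives of its entries are taken with respect to `s`. -/
structure IsBryantEnd (Ω : Set ℂ) (F : ℂ → Matrix (Fin 2) (Fin 2) ℂ) (X : ℂ → ℂ × ℝ) : Prop where
  isOpen : IsOpen Ω
  zero_mem : (0 : ℂ) ∈ Ω
  /-- the entries are holomorphic -/
  holomorphic : ∀ i j, DifferentiableOn ℂ (fun s => F s i j) {s | Complex.exp s ∈ Ω}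
  /-- `A D - B C = 1` -/
  det_eq_one : ∀ s, Complex.exp s ∈ Ω → F s 0 0 * F s 1 1 - F s 0 1 * F s 1 0 = 1
  /-- `dA dD - dB dC = 0` -/
  null : ∀ s, Complex.exp s ∈ Ω →
    deriv (fun t => F t 0 0) s * deriv (fun t => F t 1 1) s
      - deriv (fun t => F t 0 1) s * deriv (fun t => F t 1 0) s = 0
  /-- `X` is the (single-valued) map represented by `F` -/
  represents : ∀ s, Complex.exp s ∈ Ω → X (Complex.exp s) = halfSpacePoint (F s)
  /-- `X` is an immersion -/
  immersion : ∀ z ∈ Ω, z ≠ 0 → Function.Injective (fderiv ℝ X z)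

/-! ### Killing fields of translations -/

/-- The isometry of the half-space that extends the Möbius transformation
`ζ ↦ (a ζ + b) / (c ζ + d)` of the Riemann sphere (Poincaré extension). -/
def poincareExtension (P : GL (Fin 2) ℂ) (p : ℂ × ℝ) : ℂ × ℝ :=
  (((P 0 0 * p.1 + P 0 1) * starRingEnd ℂ (P 1 0 * p.1 + P 1 1)
        + P 0 0 * starRingEnd ℂ (P 1 0) * (p.2 : ℂ) ^ 2) /
      ((‖P 1 0 * p.1 + P 1 1‖ ^ 2 + ‖P 1 0‖ ^ 2 * p.2 ^ 2 : ℝ) : ℂ),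
    ‖P 0 0 * P 1 1 - P 0 1 * P 1 0‖ * p.2 /
      (‖P 1 0 * p.1 + P 1 1‖ ^ 2 + ‖P 1 0‖ ^ 2 * p.2 ^ 2))

/-- `Φ t` is the translation of distance `t` along the oriented geodesic from `𝒞` to `𝒟`:
the translation `p ↦ eᵗ p` along the geodesic from `0` to `∞`, transported by a direct isometry
which maps `0` to `𝒞` and `∞` to `𝒟`. -/
def IsTranslationFlow (𝒞 𝒟 : OnePoint ℂ) (Φ : ℝ → ℂ × ℝ → ℂ × ℝ) : Prop :=
  ∃ P : GL (Fin 2) ℂ, P • ((0 : ℂ) : OnePoint ℂ) = 𝒞 ∧ P • (OnePoint.infty : OnePoint ℂ) = 𝒟 ∧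
    ∀ t : ℝ, ∀ p ∈ halfSpace,
      Φ t (poincareExtension P p) = poincareExtension P (Real.exp t • p)

/-- `Y` is the Killing field associated to the translation along the geodesic from `𝒞` to `𝒟`:
`dΦ_t/dt = Y(Φ_t)`. -/
def IsTranslationKillingField (𝒞 𝒟 : OnePoint ℂ) (Y : ℂ × ℝ → ℂ × ℝ) : Prop :=
  ∃ Φ : ℝ → ℂ × ℝ → ℂ × ℝ, IsTranslationFlow 𝒞 𝒟 Φ ∧
    ∀ t : ℝ, ∀ p ∈ halfSpace, HasDerivAt (fun r => Φ r p) (Y (Φ t p)) t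

/-! ### The flux of a vector field through an end -/

/-- The loop `γ`, parametrised by `ℝ / 2πℤ`, is freely homotopic in `Ω \ {0}` to the circle
`τ ↦ ρ exp(i n τ)` around the puncture, for some `ρ` with `{|z| ≤ ρ} ⊆ Ω`.  (As `γ` is `C²`, it
does not matter that the homotopy is taken `C²`.) -/
def WindsAround (Ω : Set ℂ) (n : ℤ) (γ : ℝ → ℂ) : Prop :=
  ∃ ρ : ℝ, 0 < ρ ∧ Metric.closedBall (0 : ℂ) ρ ⊆ Ω ∧
    ∃ H : ℝ × ℝ → ℂ, ContDiff ℝ 2 H ∧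
      (∀ r τ, H (r, τ + 2 * Real.pi) = H (r, τ)) ∧
      (∀ r ∈ Icc (0 : ℝ) 1, ∀ τ, H (r, τ) ∈ Ω \ {0}) ∧
      (∀ τ, H (0, τ) = γ τ) ∧
      (∀ τ, H (1, τ) = ρ * Complex.exp (n * τ * Complex.I))

/-- The velocity of the curve `Γ = X ∘ γ`. -/
def velocity (X : ℂ → ℂ × ℝ) (γ : ℝ → ℂ) (τ : ℝ) : ℂ × ℝ := deriv (fun r => X (γ r)) τ

/-- `(γ, η, K)` is a choice of the data which enter the definition of the flux through the end
`X : Ω \ {0} → ℍ³`: `Γ = X ∘ γ` is a regular closed curve on the end that generates its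
fundamental group, `η` is its unit conormal in the direction of the puncture, `Γ` is oriented so
that `(Γ, η, -H)` is direct (`H` the mean curvature vector), and `K` is a (parametrised) disk with
boundary `Γ`. -/
structure IsFluxData (Ω : Set ℂ) (X : ℂ → ℂ × ℝ) (γ : ℝ → ℂ) (η : ℝ → ℂ × ℝ)
    (K : ℂ → ℂ × ℝ) : Prop where
  contDiff_curve : ContDiff ℝ 2 γ
  periodic : ∀ τ, γ (τ + 2 * Real.pi) = γ τ
  regular : ∀ τ, deriv γ τ ≠ 0
  /-- `γ` generates the fundamental group, and `η = dX(v)` is the unit conormal with `v` on the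
  side of the puncture: to the left of `γ` if it runs once counterclockwise around `0`, and to the
  right if it runs once clockwise. -/
  conormal : ∃ n : ℤ, (n = 1 ∨ n = -1) ∧ WindsAround Ω n γ ∧
    ∀ τ, ∃ v : ℂ, 0 < (n : ℝ) * (starRingEnd ℂ (deriv γ τ) * v).im ∧
      η τ = fderiv ℝ X (γ τ) v ∧
      hypInner (X (γ τ)) (η τ) (velocity X γ τ) = 0 ∧
      hypInner (X (γ τ)) (η τ) (η τ) = 1
  /-- `(Γ, η, -H)` is direct -/
  direct : ∀ τ, 0 < hypVol (X (γ τ)) (velocity X γ τ) (η τ) (-meanCurvatureVector X (γ τ))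
  contDiff_disk : ContDiff ℝ 2 K
  disk_mem : ∀ z ∈ Metric.closedBall (0 : ℂ) 1, K z ∈ halfSpace
  /-- the boundary of `K` is `Γ`, with its orientation -/
  boundary : ∀ τ : ℝ, K (Complex.exp (τ * Complex.I)) = X (γ τ)

/-- The vector `K_x × K_y`.  Its norm is the area density of `K`, and its direction is that of the
unit normal to `K` for which the induced orientation of the boundary is the counterclockwise
one. -/
def diskCross (K : ℂ → ℂ × ℝ) (z : ℂ) : ℂ × ℝ :=
  hypCross (K z) (fderiv ℝ K z 1) (fderiv ℝ K z Complex.I)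

/-- The unit normal `ν` to `K` (points where `K` is not immersed carry no area). -/
def diskNormal (K : ℂ → ℂ × ℝ) (z : ℂ) : ℂ × ℝ :=
  (hypNorm (K z) (diskCross K z))⁻¹ • diskCross K z

/-- `∫_Γ ⟨η, Y⟩ - 2 ∫_K ⟨ν, Y⟩`, the integrals being taken with respect to arc length and area. -/
def fluxValue (X : ℂ → ℂ × ℝ) (Y : ℂ × ℝ → ℂ × ℝ) (γ : ℝ → ℂ) (η : ℝ → ℂ × ℝ)
    (K : ℂ → ℂ × ℝ) : ℝ :=
  (∫ τ in (0 : ℝ)..(2 * Real.pi),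
      hypInner (X (γ τ)) (η τ) (Y (X (γ τ))) * hypNorm (X (γ τ)) (velocity X γ τ))
    - 2 * ∫ z in Metric.closedBall (0 : ℂ) 1,
        hypInner (K z) (diskNormal K z) (Y (K z)) * hypNorm (K z) (diskCross K z)

/-- The flux of `Y` through the end `X : Ω \ {0} → ℍ³` is `φ`: the defining expression can be
formed, and it has the value `φ` whatever the choices made. -/
def IsFlux (Ω : Set ℂ) (X : ℂ → ℂ × ℝ) (Y : ℂ × ℝ → ℂ × ℝ) (φ : ℝ) : Prop :=
  (∃ γ η K, IsFluxData Ω X γ η K) ∧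
    ∀ γ η K, IsFluxData Ω X γ η K → fluxValue X Y γ η K = φ

/-! ### Residues -/

/-- The one-form `h(s) ds` on the covering `{s | exp s ∈ Ω}` is the pullback under `z = exp s` of
the holomorphic one-form `f(z) dz` on `Ω \ {0}`. -/
def IsPullback (Ω : Set ℂ) (h f : ℂ → ℂ) : Prop :=
  DifferentiableOn ℂ f (Ω \ {0}) ∧
    ∀ s, Complex.exp s ∈ Ω → h s = f (Complex.exp s) * Complex.exp s

/-- The residue at `0` of `f(z) dz`, for `f` holomorphic in a punctured neighbourhood of `0` (the
integral is then the same for all sufficiently small circles). -/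
def residueAtZero (f : ℂ → ℂ) : ℂ :=
  limUnder (𝓝[>] (0 : ℝ)) fun ρ => (2 * Real.pi * Complex.I)⁻¹ * ∮ z in C(0, ρ), f z

/-- `(φ₂ 𝒞 𝒟 + φ₁ (𝒞 + 𝒟) + φ₀) / (𝒞 - 𝒟)` for distinct points of the Riemann sphere, with its
limiting value when one of them is `∞`. -/
def fluxQuotient (φ₀ φ₁ φ₂ : ℂ) : OnePoint ℂ → OnePoint ℂ → ℂ
  | OnePoint.some c, OnePoint.some d => (φ₂ * c * d + φ₁ * (c + d) + φ₀) / (c - d)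
  | OnePoint.infty, OnePoint.some d => φ₂ * d + φ₁
  | OnePoint.some c, OnePoint.infty => -(φ₂ * c + φ₁)
  | OnePoint.infty, OnePoint.infty => 0

end BryantFlux

end

/-! Differentiating `F` gives `dF = M F`, where `M = dF F⁻¹` is traceless because `det F = 1`. Hence
`X` moves along infinitesimal isometries: `dX(v)` is the value at `X` of the Killing field with
matrix `v M`, whose entries are up to sign the three forms of the theorem
(`hasFDerivAt_halfSpacePoint`). The real-linear map `dX` determines `M` (`killingL_injective`), so
`M` is single-valued because `X` is. The null condition says `det M = 0`, and this makes `X`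
conformal.

For a Killing field `Y` with traceless matrix `N` there is a one-form `β` on the half-space with `dβ
= -2 ι_Y vol` (`exteriorDerivative_fluxFormL`) such that `⟨dX(iv), Y⟩ = -2 Im (v tr(M N)) +
β(dX(v))` (`hypInner_killingL_I_mul`). The mean curvature vector is a positive multiple of `X_x ×
X_y`, so the orientation rule forces `γ` to run clockwise, and `|Γ'| η = -dX(iγ')`. The curve
integral is then `2 Im ∫_γ tr(M N) - ∫_Γ β`. By Stokes on `K`, the disk term `-2 ∫_K ⟨ν, Y⟩` equals
`∫_Γ β`, and the two boundary integrals cancel. What is left is the period of a holomorphic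
one-form, which depends on neither `K` nor `γ` and is given by residues.

Finally, the matrix of a translation is a conjugate of a diagonal one, so it is explicit in its two
fixed points; the trace pairing becomes the stated quotient
(`IsTranslationKillingField.eq_killing`). -/

namespace BryantFlux

/-! ### Killing fields as traceless matrices, and their pointwise identities -/

/-- The Killing field `(r - 2pζ - qζ² + w² conj q, -2w Re (p + qζ))`, given by the traceless
matrix `(p q; r -p)` acting on the Hermitian model. -/
noncomputable def killing (p q r : ℂ) (x : ℂ × ℝ) : ℂ × ℝ :=
  (r - 2 * p * x.1 - q * x.1 ^ 2 + (x.2 : ℂ) ^ 2 * starRingEnd ℂ q,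
    -2 * x.2 * (p + q * x.1).re)

/-- The real linear map `v ↦ killing (v p) (v q) (v r) x`. -/
noncomputable def killingL (p q r : ℂ) (x : ℂ × ℝ) : ℂ →L[ℝ] ℂ × ℝ :=
  (((r - 2 * p * x.1 - q * x.1 ^ 2) • (1 : ℂ →L[ℝ] ℂ)) +
      (((x.2 : ℂ) ^ 2 * starRingEnd ℂ q) • (Complex.conjCLE : ℂ →L[ℝ] ℂ))).prod
    ((-2 * x.2) • (Complex.reCLM.comp ((p + q * x.1) • (1 : ℂ →L[ℝ] ℂ))))

theorem killingL_apply (p q r : ℂ) (x : ℂ × ℝ) (v : ℂ) :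
    killingL p q r x v = killing (v * p) (v * q) (v * r) x := by
  simp only [killingL, killing]
  refine Prod.ext ?_ ?_
  · simp; ring
  · simp; ring_nf; simp

theorem killingL_apply' (p q r : ℂ) (x : ℂ × ℝ) (v : ℂ) :
    killingL p q r x v = (v * (r - 2 * p * x.1 - q * x.1 ^ 2)
      + starRingEnd ℂ v * ((x.2 : ℂ) ^ 2 * starRingEnd ℂ q),
      -2 * x.2 * (v * (p + q * x.1)).re) := by
  simp only [killingL]
  refine Prod.ext ?_ ?_
  · simp; ring
  · simp; ring_nf; simp

/-- The antilinear part in `v` determines `q`, the height component determines `p`, and the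
remaining linear part then gives `r`. This is the source of single-valuedness. -/
theorem killingL_injective {p q r p' q' r' : ℂ} {x : ℂ × ℝ} (hx : x ∈ halfSpace)
    (h : killingL p q r x = killingL p' q' r' x) : p = p' ∧ q = q' ∧ r = r' := by
  have hw : x.2 ≠ 0 := ne_of_gt hx
  have h1 : killingL p q r x 1 = killingL p' q' r' x 1 := by rw [h]
  have hI : killingL p q r x Complex.I = killingL p' q' r' x Complex.I := by rw [h]
  simp only [killingL_apply', Prod.mk.injEq, map_one, Complex.conj_I, one_mul] at h1 hI
  obtain ⟨h11, h12⟩ := h1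
  obtain ⟨h21, h22⟩ := hI
  have hI2 : Complex.I * Complex.I = -1 := Complex.I_mul_I
  have hwc : (x.2 : ℂ) ≠ 0 := by exact_mod_cast hw
  have hq : q = q' := by
    -- For a real-linear `T`, the antilinear coefficient is `(T 1 + i T i) / 2`.
    have : (x.2 : ℂ) ^ 2 * starRingEnd ℂ q = (x.2 : ℂ) ^ 2 * starRingEnd ℂ q' := by
      linear_combination (1 / 2) * h11 + (Complex.I / 2) * h21
        + (-1 / 2) * (r - 2 * p * x.1 - q * x.1 ^ 2 - (r' - 2 * p' * x.1 - q' * x.1 ^ 2)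
          - (x.2 : ℂ) ^ 2 * starRingEnd ℂ q + (x.2 : ℂ) ^ 2 * starRingEnd ℂ q') * hI2
    exact (starRingEnd ℂ).injective (mul_left_cancel₀ (pow_ne_zero 2 hwc) this)
  subst hq
  have hp : p = p' := by
    have e1 := mul_left_cancel₀ (mul_ne_zero (by norm_num : (-2 : ℝ) ≠ 0) hw) h12
    have e2 := mul_left_cancel₀ (mul_ne_zero (by norm_num : (-2 : ℝ) ≠ 0) hw) h22
    apply Complex.ext
    · simpa using e1
    · simpa using e2
  subst hp
  refine ⟨rfl, rfl, ?_⟩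
  linear_combination h11

/-- A quadratic form in `v` is a multiple of `|v|²` exactly when its `v²` coefficient vanishes. Here
that coefficient is a multiple of `q k + m²`, with `k = r - 2pζ - qζ²` and `m = p + qζ`; it equals
`p² + qr`, whatever the point. -/
theorem hypInner_killingL {p q r : ℂ} (h : p ^ 2 + q * r = 0) (x : ℂ × ℝ) (a b : ℂ) :
    hypInner x (killingL p q r x a) (killingL p q r x b) =
      (starRingEnd ℂ a * b).re *
        hypInner x (killingL p q r x 1) (killingL p q r x 1) := by
  simp only [killingL_apply', hypInner, map_one, one_mul]
  have hk : q * (r - 2 * p * x.1 - q * x.1 ^ 2) + (p + q * x.1) ^ 2 = 0 := by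
    linear_combination h
  generalize r - 2 * p * x.1 - q * x.1 ^ 2 = k at hk ⊢
  generalize p + q * x.1 = m at hk ⊢
  rw [← mul_div_assoc]
  congr 1
  obtain ⟨k1, k2⟩ := k
  obtain ⟨m1, m2⟩ := m
  obtain ⟨q1, q2⟩ := q
  obtain ⟨a1, a2⟩ := a
  obtain ⟨b1, b2⟩ := b
  generalize x.2 = w
  have hr := congrArg Complex.re hk
  have hi := congrArg Complex.im hk
  simp [pow_two] at hr hi ⊢
  linear_combination (2 * w ^ 2 * (a1 * b1 - a2 * b2 - (a1 * b1 + a2 * b2))) * hr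
    - (2 * w ^ 2 * (a1 * b2 + a2 * b1)) * hi

/-- The one-form `β` with `dβ = -2 ι_Y vol` for `Y = killing P Q R`. -/
noncomputable def fluxForm (P Q R : ℂ) (x V : ℂ × ℝ) : ℝ :=
  (starRingEnd ℂ V.1 * ((R - 2 * P * x.1 - Q * x.1 ^ 2) / (x.2 : ℂ) ^ 2) + Q * V.1
    - 2 * (V.2 / x.2 : ℝ) * (P + Q * x.1)).im

/-- The core of the flux formula: all dependence on the point `x` is absorbed by `fluxForm`, and the
remainder is the trace of the product of the two matrices, which is complex linear in `v` before the
imaginary part is taken. -/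
theorem hypInner_killingL_I_mul (p q r P Q R : ℂ) {x : ℂ × ℝ} (hx : x ∈ halfSpace) (v : ℂ) :
    hypInner x (killingL p q r x (Complex.I * v)) (killing P Q R x) =
      -2 * (v * (2 * p * P + q * R + r * Q)).im + fluxForm P Q R x (killingL p q r x v) := by
  have hw : x.2 ≠ 0 := ne_of_gt hx
  have hwc : (x.2 : ℂ) ^ 2 = ((x.2 ^ 2 : ℝ) : ℂ) := by push_cast; rfl
  simp only [killingL_apply, hypInner, killing, fluxForm, hwc]
  obtain ⟨⟨z1, z2⟩, w⟩ := x
  obtain ⟨p1, p2⟩ := p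
  obtain ⟨q1, q2⟩ := q
  obtain ⟨r1, r2⟩ := r
  obtain ⟨P1, P2⟩ := P
  obtain ⟨Q1, Q2⟩ := Q
  obtain ⟨R1, R2⟩ := R
  obtain ⟨v1, v2⟩ := v
  simp only [Complex.div_ofReal_im, Complex.div_ofReal_re, Complex.sub_im, Complex.add_im,
    Complex.mul_im, Complex.mul_re, Complex.sub_re, Complex.add_re, Complex.conj_re, Complex.conj_im,
    Complex.ofReal_re, Complex.ofReal_im, pow_two, Complex.I_re, Complex.I_im, Complex.re_ofNat, Complex.im_ofNat] at hw ⊢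
  field_simp
  ring

/-- With the last slot fixed this is an alternating form on the plane, hence a multiple of the area
form `Im (conj a * b)`. -/
theorem hypVol_map (T : ℂ →L[ℝ] ℂ × ℝ) (x W : ℂ × ℝ) (a b : ℂ) :
    hypVol x (T a) (T b) W = (starRingEnd ℂ a * b).im * hypVol x (T 1) (T Complex.I) W := by
  have e : ∀ c : ℂ, T c = c.re • T 1 + c.im • T Complex.I := by
    intro c
    rw [← map_smul, ← map_smul, ← map_add]
    congr 1
    apply Complex.ext <;> simp
  rw [e a, e b]
  generalize T 1 = U
  generalize T Complex.I = V
  simp only [hypVol, Matrix.det_fin_three]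
  simp
  ring

theorem hypInner_hypCross_self (x U V : ℂ × ℝ) (hx : x ∈ halfSpace) :
    hypInner x (hypCross x U V) (hypCross x U V) =
      hypInner x U U * hypInner x V V - hypInner x U V ^ 2 := by
  have hw : x.2 ≠ 0 := ne_of_gt hx
  simp only [hypInner, hypCross]
  simp
  field_simp
  ring

/-! ### The differential of the map represented by `F` -/

theorem hasDerivAt_line {E : Type*} [NormedAddCommGroup E] [NormedSpace ℝ E] {f : ℂ → E}
    {L : ℂ →L[ℝ] E} {z : ℂ} (h : HasFDerivAt f L z) (v : ℂ) :
    HasDerivAt (fun t : ℝ => f (z + t * v)) (L v) 0 := by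
  have h1 : HasDerivAt (fun t : ℝ => z + (t : ℂ) * v) v 0 := by
    simpa using ((Complex.ofRealCLM.hasDerivAt (x := (0 : ℝ))).mul_const v).const_add z
  have h2 : HasFDerivAt f L (z + ((0 : ℝ) : ℂ) * v) := by simpa using h
  exact h2.comp_hasDerivAt (0 : ℝ) h1

theorem hasDerivAt_line_of_hasDerivAt {f : ℂ → ℂ} {f' z : ℂ} (h : HasDerivAt f f' z) (v : ℂ) :
    HasDerivAt (fun t : ℝ => f (z + t * v)) (v * f') 0 := by
  simpa using hasDerivAt_line (h.hasFDerivAt.restrictScalars ℝ) v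

theorem hasFDerivAt_of_lines {E : Type*} [NormedAddCommGroup E] [NormedSpace ℝ E] {f : ℂ → E}
    {L : ℂ →L[ℝ] E} {z : ℂ} (hf : DifferentiableAt ℝ f z)
    (h : ∀ v, HasDerivAt (fun t : ℝ => f (z + t * v)) (L v) 0) : HasFDerivAt f L z := by
  have : fderiv ℝ f z = L := by
    ext1 v
    exact (hasDerivAt_line hf.hasFDerivAt v).unique (h v)
  exact this ▸ hf.hasFDerivAt

theorem hasDerivAt_conj {f : ℝ → ℂ} {f' : ℂ} {t : ℝ} (h : HasDerivAt f f' t) :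
    HasDerivAt (fun t => starRingEnd ℂ (f t)) (starRingEnd ℂ f') t :=
  (Complex.conjCLE : ℂ →L[ℝ] ℂ).hasFDerivAt.comp_hasDerivAt t h

theorem hasDerivAt_re {f : ℝ → ℂ} {f' : ℂ} {t : ℝ} (h : HasDerivAt f f' t) :
    HasDerivAt (fun t => (f t).re) f'.re t :=
  Complex.reCLM.hasFDerivAt.comp_hasDerivAt t h

theorem halfSpacePoint_eq (a b c d : ℂ) :
    halfSpacePoint !![a, b; c, d] =
      ((starRingEnd ℂ a * c + starRingEnd ℂ b * d) / (starRingEnd ℂ a * a + starRingEnd ℂ b * b),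
        1 / (starRingEnd ℂ a * a + starRingEnd ℂ b * b).re) := by
  have h : starRingEnd ℂ a * a + starRingEnd ℂ b * b = ((‖a‖ ^ 2 + ‖b‖ ^ 2 : ℝ) : ℂ) := by
    rw [Complex.conj_mul', Complex.conj_mul']; push_cast; rfl
  rw [h, Complex.ofReal_re]
  simp [halfSpacePoint]

theorem sq_norm_add_pos {a b c d : ℂ} (h : a * d - b * c = 1) : 0 < ‖a‖ ^ 2 + ‖b‖ ^ 2 := by
  by_cases ha : a = 0
  · have hb : b ≠ 0 := by rintro rfl; simp [ha] at h
    have := norm_pos_iff.2 hb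
    positivity
  · have := norm_pos_iff.2 ha
    positivity

theorem halfSpacePoint_mem {a b c d : ℂ} (h : a * d - b * c = 1) :
    halfSpacePoint !![a, b; c, d] ∈ halfSpace := by
  have := sq_norm_add_pos h
  simpa [halfSpacePoint, halfSpace] using this

theorem contDiffAt_halfSpacePoint {A B C D : ℂ → ℂ} {z : ℂ} {n : WithTop ℕ∞}
    (hA : ContDiffAt ℝ n A z) (hB : ContDiffAt ℝ n B z) (hC : ContDiffAt ℝ n C z)
    (hD : ContDiffAt ℝ n D z) (h : A z * D z - B z * C z = 1) :
    ContDiffAt ℝ n (fun y => halfSpacePoint !![A y, B y; C y, D y]) z := by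
  have hpos := sq_norm_add_pos h
  have e : starRingEnd ℂ (A z) * A z + starRingEnd ℂ (B z) * B z
      = ((‖A z‖ ^ 2 + ‖B z‖ ^ 2 : ℝ) : ℂ) := by
    rw [Complex.conj_mul', Complex.conj_mul']; push_cast; rfl
  have hc : ∀ {f : ℂ → ℂ}, ContDiffAt ℝ n f z → ContDiffAt ℝ n (fun y => starRingEnd ℂ (f y)) z :=
    fun hf => (Complex.conjCLE : ℂ →L[ℝ] ℂ).contDiff.contDiffAt.comp z hf
  have hN : ContDiffAt ℝ n (fun y => starRingEnd ℂ (A y) * A y + starRingEnd ℂ (B y) * B y) z :=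
    ((hc hA).mul hA).add ((hc hB).mul hB)
  simp only [halfSpacePoint_eq, div_eq_mul_inv]
  refine ContDiffAt.prodMk ((((hc hA).mul hC).add ((hc hB).mul hD)).mul (hN.inv ?_)) ?_
  · rw [e]; exact_mod_cast hpos.ne'
  · refine contDiffAt_const.mul ((Complex.reCLM.contDiff.contDiffAt.comp z hN).inv ?_)
    rw [Function.comp_apply, e]; exact hpos.ne'

/-- The point is read off the Hermitian matrix `F F*`, with entries `n`, `S`, `T` and determinant
one, as `(S / n, 1 / n)`. Since `F' = M F`, this matrix varies by `v M F F* + F F* (v M)*`, the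
infinitesimal action of `v M`. -/
theorem hasFDerivAt_halfSpacePoint {A B C D : ℂ → ℂ} {A' B' C' D' z : ℂ}
    (hA : HasDerivAt A A' z) (hB : HasDerivAt B B' z) (hC : HasDerivAt C C' z)
    (hD : HasDerivAt D D' z) (hcA : ContDiffAt ℝ 1 A z) (hcB : ContDiffAt ℝ 1 B z)
    (hcC : ContDiffAt ℝ 1 C z) (hcD : ContDiffAt ℝ 1 D z) (h : A z * D z - B z * C z = 1)
    (h' : A' * D z + A z * D' - (B' * C z + B z * C') = 0) :
    HasFDerivAt (fun y => halfSpacePoint !![A y, B y; C y, D y])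
      (killingL (A' * D z - B' * C z) (A z * B' - A' * B z) (C' * D z - C z * D')
        (halfSpacePoint !![A z, B z; C z, D z])) z := by
  refine hasFDerivAt_of_lines
    ((contDiffAt_halfSpacePoint hcA hcB hcC hcD h).differentiableAt (by simp)) fun v => ?_
  have hpos := sq_norm_add_pos h
  have e : starRingEnd ℂ (A z) * A z + starRingEnd ℂ (B z) * B z
      = ((‖A z‖ ^ 2 + ‖B z‖ ^ 2 : ℝ) : ℂ) := by
    rw [Complex.conj_mul', Complex.conj_mul']; push_cast; rfl
  obtain ⟨p, hp⟩ : ∃ p, A' * D z - B' * C z = p := ⟨_, rfl⟩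
  obtain ⟨q, hq⟩ : ∃ q, A z * B' - A' * B z = q := ⟨_, rfl⟩
  obtain ⟨r, hr⟩ : ∃ r, C' * D z - C z * D' = r := ⟨_, rfl⟩
  -- These four equations are `F' = M F`; the bottom row uses that `M` has trace zero.
  have eA : A' = p * A z + q * C z := by
    subst hp hq; linear_combination (-A') * h
  have eB : B' = p * B z + q * D z := by
    subst hp hq; linear_combination (-B') * h
  have eC : C' = r * A z - p * C z := by
    subst hp hr; linear_combination (-C') * h + C z * h'
  have eD : D' = r * B z - p * D z := by
    subst hp hr; linear_combination (-D') * h + D z * h'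
  rw [hp, hq, hr]
  have lA := hasDerivAt_line_of_hasDerivAt hA v
  have lB := hasDerivAt_line_of_hasDerivAt hB v
  have lC := hasDerivAt_line_of_hasDerivAt hC v
  have lD := hasDerivAt_line_of_hasDerivAt hD v
  have lS := ((hasDerivAt_conj lA).mul lC).add ((hasDerivAt_conj lB).mul lD)
  have lN := ((hasDerivAt_conj lA).mul lA).add ((hasDerivAt_conj lB).mul lB)
  have hn : (starRingEnd ℂ (A (z + ((0 : ℝ) : ℂ) * v)) * A (z + ((0 : ℝ) : ℂ) * v)
      + starRingEnd ℂ (B (z + ((0 : ℝ) : ℂ) * v)) * B (z + ((0 : ℝ) : ℂ) * v)) ≠ 0 := by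
    simp only [Complex.ofReal_zero, zero_mul, add_zero, e]
    exact_mod_cast hpos.ne'
  have hn' : (starRingEnd ℂ (A (z + ((0 : ℝ) : ℂ) * v)) * A (z + ((0 : ℝ) : ℂ) * v)
      + starRingEnd ℂ (B (z + ((0 : ℝ) : ℂ) * v)) * B (z + ((0 : ℝ) : ℂ) * v)).re ≠ 0 := by
    simp only [Complex.ofReal_zero, zero_mul, add_zero, e]
    exact hpos.ne'
  have key := (lS.div lN hn).prodMk ((hasDerivAt_const (0 : ℝ) (1 : ℝ)).div (hasDerivAt_re lN) hn')
  simp only [halfSpacePoint_eq]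
  refine key.congr_deriv ?_
  simp only [Pi.add_apply, Pi.mul_apply, Complex.ofReal_zero, zero_mul, add_zero] at hn hn' ⊢
  rw [killingL_apply']
  have hc : starRingEnd ℂ (A z) * starRingEnd ℂ (D z)
      - starRingEnd ℂ (B z) * starRingEnd ℂ (C z) = 1 := by
    simpa using congrArg (starRingEnd ℂ) h
  obtain ⟨n, hnn⟩ : ∃ n : ℝ, ‖A z‖ ^ 2 + ‖B z‖ ^ 2 = n := ⟨_, rfl⟩
  rw [hnn] at e hpos
  have hn0 : (n : ℂ) ≠ 0 := by exact_mod_cast hpos.ne'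
  obtain ⟨S, hS⟩ : ∃ S, starRingEnd ℂ (A z) * C z + starRingEnd ℂ (B z) * D z = S := ⟨_, rfl⟩
  obtain ⟨T, hT⟩ : ∃ T, starRingEnd ℂ (C z) * C z + starRingEnd ℂ (D z) * D z = T := ⟨_, rfl⟩
  have hSc : A z * starRingEnd ℂ (C z) + B z * starRingEnd ℂ (D z) = starRingEnd ℂ S := by
    rw [← hS]; simp
  -- This is `det (F F*) = 1`.
  have hST : n * T - S * starRingEnd ℂ S = 1 := by
    rw [← hSc, ← hS, ← hT, ← e]
    linear_combination (starRingEnd ℂ (A z) * starRingEnd ℂ (D z)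
      - starRingEnd ℂ (B z) * starRingEnd ℂ (C z)) * h + hc
  have dN : starRingEnd ℂ (v * A') * A z + starRingEnd ℂ (A z) * (v * A')
      + (starRingEnd ℂ (v * B') * B z + starRingEnd ℂ (B z) * (v * B'))
      = v * (p * n + q * S) + starRingEnd ℂ (v * (p * n + q * S)) := by
    rw [eA, eB]
    simp only [map_mul, map_add, ← hSc, Complex.conj_ofReal]
    rw [← hS, ← e]
    ring
  have dS : starRingEnd ℂ (v * A') * C z + starRingEnd ℂ (A z) * (v * C')
      + (starRingEnd ℂ (v * B') * D z + starRingEnd ℂ (B z) * (v * D'))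
      = v * (r * n - p * S) + starRingEnd ℂ v * (starRingEnd ℂ p * S + starRingEnd ℂ q * T) := by
    rw [eA, eB, eC, eD]
    simp only [map_mul, map_add]
    rw [← hS, ← hT, ← e]
    ring
  rw [dN, dS, hS, e]
  refine Prod.ext ?_ ?_
  · simp only [map_mul, map_add, Complex.conj_ofReal, Complex.ofReal_re]
    push_cast
    field_simp
    linear_combination (starRingEnd ℂ v * starRingEnd ℂ q) * hST
  · have hn1 : n ≠ 0 := hpos.ne'
    have : v * (p + q * (S / n)) = v * (p * n + q * S) / n := by field_simp
    simp only [Complex.ofReal_re, this, Complex.add_re, Complex.conj_re, Complex.div_ofReal_re]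
    field_simp
    ring

/-! ### Descent from the logarithmic covering to the punctured neighbourhood -/

/-- A branch of the logarithm near `exp s`. -/
theorem exists_log_branch (s : ℂ) : ∃ L : ℂ → ℂ, L (Complex.exp s) = s ∧
    (∀ z, z ≠ 0 → Complex.exp (L z) = z) ∧ HasDerivAt L (Complex.exp s)⁻¹ (Complex.exp s) ∧
    (∀ᶠ z in 𝓝 (Complex.exp s), DifferentiableAt ℂ L z) := by
  have h0 := Complex.exp_ne_zero s
  have hd : ∀ z, z / Complex.exp s ∈ Complex.slitPlane →
      HasDerivAt (fun z => Complex.log (z / Complex.exp s) + s)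
        (1 / Complex.exp s / (z / Complex.exp s)) z := fun z hz =>
    (((hasDerivAt_id z).div_const _).clog hz).add_const s
  refine ⟨fun z => Complex.log (z / Complex.exp s) + s, ?_, ?_, ?_, ?_⟩
  · simp
  · intro z hz
    rw [Complex.exp_add, Complex.exp_log (div_ne_zero hz h0), div_mul_cancel₀ _ h0]
  · convert hd (Complex.exp s) (by simp) using 1
    field_simp
  · have : ContinuousAt (fun z => z / Complex.exp s) (Complex.exp s) :=
      continuousAt_id.div_const _
    have := this.preimage_mem_nhds
      (Complex.isOpen_slitPlane.mem_nhds (by simp))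
    filter_upwards [this] with z hz using (hd z hz).differentiableAt

variable {Ω : Set ℂ} {A B C D : ℂ → ℂ} {X : ℂ → ℂ × ℝ}

theorem isOpen_exp_preimage (hΩ : IsOpen Ω) : IsOpen {s | Complex.exp s ∈ Ω} :=
  hΩ.preimage Complex.continuous_exp

/-- Near `exp s` the map `X` is the half-space point of `F` composed with a branch of the logarithm;
the denominators `exp s` come from the chain rule. -/
theorem IsBryantEnd.local_representation
    (hE : IsBryantEnd Ω (fun s => !![A s, B s; C s, D s]) X) {s : ℂ} (hs : Complex.exp s ∈ Ω) :
    (∀ n : WithTop ℕ∞, ContDiffAt ℝ n X (Complex.exp s)) ∧ X (Complex.exp s) ∈ halfSpace ∧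
    HasFDerivAt X (killingL
      (-(C s * deriv B s - D s * deriv A s) / Complex.exp s)
      (-(B s * deriv A s - A s * deriv B s) / Complex.exp s)
      ((D s * deriv C s - C s * deriv D s) / Complex.exp s) (X (Complex.exp s)))
      (Complex.exp s) := by
  obtain ⟨L, hL, hexp, hLd, hLev⟩ := exists_log_branch s
  have hW := isOpen_exp_preimage hE.isOpen
  have hdA : DifferentiableOn ℂ A {s | Complex.exp s ∈ Ω} := by simpa using hE.holomorphic 0 0
  have hdB : DifferentiableOn ℂ B {s | Complex.exp s ∈ Ω} := by simpa using hE.holomorphic 0 1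
  have hdC : DifferentiableOn ℂ C {s | Complex.exp s ∈ Ω} := by simpa using hE.holomorphic 1 0
  have hdD : DifferentiableOn ℂ D {s | Complex.exp s ∈ Ω} := by simpa using hE.holomorphic 1 1
  have hdet : ∀ t, Complex.exp t ∈ Ω → A t * D t - B t * C t = 1 := by simpa using hE.det_eq_one
  have h0 := Complex.exp_ne_zero s
  have hne : ∀ᶠ z in 𝓝 (Complex.exp s), z ≠ 0 ∧ z ∈ Ω :=
    (eventually_ne_nhds h0).and (hE.isOpen.mem_nhds hs)
  have hX : X =ᶠ[𝓝 (Complex.exp s)]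
      fun z => halfSpacePoint !![A (L z), B (L z); C (L z), D (L z)] := by
    filter_upwards [hne] with z hz
    have := hE.represents (L z) (by rw [hexp z hz.1]; exact hz.2)
    rwa [hexp z hz.1] at this
  have hLa : AnalyticAt ℂ L (Complex.exp s) := Complex.analyticAt_iff_eventually_differentiableAt.2 hLev
  have cd : ∀ {f : ℂ → ℂ}, DifferentiableOn ℂ f {s | Complex.exp s ∈ Ω} → ∀ n : WithTop ℕ∞,
      ContDiffAt ℝ n (fun z => f (L z)) (Complex.exp s) := by
    intro f hf n
    have h1 : AnalyticAt ℂ f (L (Complex.exp s)) := by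
      rw [hL]; exact hf.analyticAt (hW.mem_nhds hs)
    exact ((h1.comp hLa).contDiffAt).restrict_scalars ℝ
  have dv : ∀ {f : ℂ → ℂ}, DifferentiableOn ℂ f {s | Complex.exp s ∈ Ω} →
      HasDerivAt (fun z => f (L z)) (deriv f s * (Complex.exp s)⁻¹) (Complex.exp s) := by
    intro f hf
    have h1 : HasDerivAt f (deriv f s) (L (Complex.exp s)) := by
      rw [hL]; exact (hf.differentiableAt (hW.mem_nhds hs)).hasDerivAt
    exact h1.comp (Complex.exp s) hLd
  have hdets : A s * D s - B s * C s = 1 := hdet s hs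
  have hd1 : A (L (Complex.exp s)) * D (L (Complex.exp s))
      - B (L (Complex.exp s)) * C (L (Complex.exp s)) = 1 := by rw [hL]; exact hdets
  have hd' : deriv A s * D s + A s * deriv D s - (deriv B s * C s + B s * deriv C s) = 0 := by
    have nh := hW.mem_nhds hs
    have k := ((hdA.differentiableAt nh).hasDerivAt.mul (hdD.differentiableAt nh).hasDerivAt).sub
      ((hdB.differentiableAt nh).hasDerivAt.mul (hdC.differentiableAt nh).hasDerivAt)
    have k2 : HasDerivAt (A * D - B * C) 0 s := by
      refine (hasDerivAt_const s (1 : ℂ)).congr_of_eventuallyEq ?_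
      filter_upwards [nh] with t ht using hdet t ht
    exact k.unique k2
  have hXs : X (Complex.exp s) = halfSpacePoint !![A s, B s; C s, D s] := by
    have := hX.eq_of_nhds; rwa [hL] at this
  refine ⟨fun n => (contDiffAt_halfSpacePoint (cd hdA n) (cd hdB n) (cd hdC n) (cd hdD n)
    hd1).congr_of_eventuallyEq hX, ?_, ?_⟩
  · rw [hXs]; exact halfSpacePoint_mem hdets
  · have key := hasFDerivAt_halfSpacePoint (dv hdA) (dv hdB) (dv hdC) (dv hdD) (cd hdA 1)
      (cd hdB 1) (cd hdC 1) (cd hdD 1) hd1 (by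
        rw [hL]; linear_combination (Complex.exp s)⁻¹ * hd')
    rw [hL, ← hXs] at key
    convert key.congr_of_eventuallyEq hX using 2 <;> ring

/-- The coefficients of the single-valued forms attached to a Bryant surface end. -/
structure IsEndData (Ω : Set ℂ) (X : ℂ → ℂ × ℝ) (f₀ f₁ f₂ : ℂ → ℂ) : Prop where
  isOpen : IsOpen Ω
  zero_mem : (0 : ℂ) ∈ Ω
  holo₀ : DifferentiableOn ℂ f₀ (Ω \ {0})
  holo₁ : DifferentiableOn ℂ f₁ (Ω \ {0})
  holo₂ : DifferentiableOn ℂ f₂ (Ω \ {0})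
  mem : ∀ z ∈ Ω \ {0}, X z ∈ halfSpace
  contDiffAt : ∀ z ∈ Ω \ {0}, ∀ n : WithTop ℕ∞, ContDiffAt ℝ n X z
  hasFDerivAt : ∀ z ∈ Ω \ {0}, HasFDerivAt X (killingL (-f₁ z) (-f₂ z) (f₀ z) (X z)) z
  null : ∀ z ∈ Ω \ {0}, (-f₁ z) ^ 2 + (-f₂ z) * f₀ z = 0
  immersion : ∀ z ∈ Ω \ {0}, Function.Injective (fderiv ℝ X z)

theorem differentiableOn_of_pullback {h f : ℂ → ℂ} (hΩ : IsOpen Ω)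
    (hh : DifferentiableOn ℂ h {s | Complex.exp s ∈ Ω})
    (hf : ∀ s, Complex.exp s ∈ Ω → h s = f (Complex.exp s) * Complex.exp s) :
    DifferentiableOn ℂ f (Ω \ {0}) := by
  rintro z ⟨hz, hz0 : z ≠ 0⟩
  refine DifferentiableAt.differentiableWithinAt ?_
  obtain ⟨L, hL, hexp, hLd, -⟩ := exists_log_branch (Complex.log z)
  rw [Complex.exp_log hz0] at hL hLd
  have hmem : Complex.exp (L z) ∈ Ω := by rw [hexp z hz0]; exact hz
  have h1 : DifferentiableAt ℂ (fun y => h (L y) / y) z :=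
    ((hh.differentiableAt ((isOpen_exp_preimage hΩ).mem_nhds hmem)).comp z
      hLd.differentiableAt).div differentiableAt_id hz0
  refine h1.congr_of_eventuallyEq ?_
  filter_upwards [hΩ.mem_nhds hz, eventually_ne_nhds hz0] with y hy hy0'
  rw [hf (L y) (by rw [hexp y hy0']; exact hy), hexp y hy0', mul_div_cancel_right₀ _ hy0']

/-- The coefficients are computed at the principal logarithm. The differential of `X` does not see
which logarithm was used, so all branches agree, and holomorphy follows from local branches,
including across the cut. -/
theorem IsBryantEnd.exists_endData
    (hE : IsBryantEnd Ω (fun s => !![A s, B s; C s, D s]) X) :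
    ∃ f₀ f₁ f₂ : ℂ → ℂ, IsEndData Ω X f₀ f₁ f₂ ∧
      IsPullback Ω (fun s => D s * deriv C s - C s * deriv D s) f₀ ∧
      IsPullback Ω (fun s => C s * deriv B s - D s * deriv A s) f₁ ∧
      IsPullback Ω (fun s => B s * deriv A s - A s * deriv B s) f₂ := by
  have hW := isOpen_exp_preimage hE.isOpen
  have hdA : DifferentiableOn ℂ A {s | Complex.exp s ∈ Ω} := by simpa using hE.holomorphic 0 0
  have hdB : DifferentiableOn ℂ B {s | Complex.exp s ∈ Ω} := by simpa using hE.holomorphic 0 1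
  have hdC : DifferentiableOn ℂ C {s | Complex.exp s ∈ Ω} := by simpa using hE.holomorphic 1 0
  have hdD : DifferentiableOn ℂ D {s | Complex.exp s ∈ Ω} := by simpa using hE.holomorphic 1 1
  have hdet : ∀ t, Complex.exp t ∈ Ω → A t * D t - B t * C t = 1 := by simpa using hE.det_eq_one
  have hnull : ∀ t, Complex.exp t ∈ Ω → deriv A t * deriv D t - deriv B t * deriv C t = 0 := by
    simpa using hE.null
  have hd' : ∀ s, Complex.exp s ∈ Ω →
      deriv A s * D s + A s * deriv D s - (deriv B s * C s + B s * deriv C s) = 0 := by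
    intro s hs
    have nh := hW.mem_nhds hs
    have k := ((hdA.differentiableAt nh).hasDerivAt.mul (hdD.differentiableAt nh).hasDerivAt).sub
      ((hdB.differentiableAt nh).hasDerivAt.mul (hdC.differentiableAt nh).hasDerivAt)
    have k2 : HasDerivAt (A * D - B * C) 0 s := by
      refine (hasDerivAt_const s (1 : ℂ)).congr_of_eventuallyEq ?_
      filter_upwards [nh] with t ht using hdet t ht
    exact k.unique k2
  set h₀ : ℂ → ℂ := fun s => D s * deriv C s - C s * deriv D s with hh₀
  set h₁ : ℂ → ℂ := fun s => C s * deriv B s - D s * deriv A s with hh₁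
  set h₂ : ℂ → ℂ := fun s => B s * deriv A s - A s * deriv B s with hh₂
  have per : ∀ s, Complex.exp s ∈ Ω →
      h₁ s = h₁ (Complex.log (Complex.exp s)) ∧ h₂ s = h₂ (Complex.log (Complex.exp s)) ∧
        h₀ s = h₀ (Complex.log (Complex.exp s)) := by
    intro s hs
    have h0 := Complex.exp_ne_zero s
    obtain ⟨-, hm, h1⟩ := hE.local_representation hs
    have he := Complex.exp_log h0
    obtain ⟨-, -, h2⟩ := hE.local_representation (s := Complex.log (Complex.exp s))
      (by rw [he]; exact hs)
    rw [he] at h2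
    obtain ⟨e1, e2, e3⟩ := killingL_injective hm (h1.unique h2)
    rw [div_left_inj' h0] at e1 e2 e3
    exact ⟨neg_injective e1, neg_injective e2, e3⟩
  have pb₀ : ∀ s, Complex.exp s ∈ Ω → h₀ s =
      (fun z => h₀ (Complex.log z) / z) (Complex.exp s) * Complex.exp s := fun s hs => by
    simp only; rw [div_mul_cancel₀ _ (Complex.exp_ne_zero s), ← (per s hs).2.2]
  have pb₁ : ∀ s, Complex.exp s ∈ Ω → h₁ s =
      (fun z => h₁ (Complex.log z) / z) (Complex.exp s) * Complex.exp s := fun s hs => by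
    simp only; rw [div_mul_cancel₀ _ (Complex.exp_ne_zero s), ← (per s hs).1]
  have pb₂ : ∀ s, Complex.exp s ∈ Ω → h₂ s =
      (fun z => h₂ (Complex.log z) / z) (Complex.exp s) * Complex.exp s := fun s hs => by
    simp only; rw [div_mul_cancel₀ _ (Complex.exp_ne_zero s), ← (per s hs).2.1]
  have ho₀ := differentiableOn_of_pullback (h := h₀)
    (f := fun z => h₀ (Complex.log z) / z) hE.isOpen
    ((hdD.mul (hdC.deriv hW)).sub (hdC.mul (hdD.deriv hW))) pb₀
  have ho₁ := differentiableOn_of_pullback (h := h₁)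
    (f := fun z => h₁ (Complex.log z) / z) hE.isOpen
    ((hdC.mul (hdB.deriv hW)).sub (hdD.mul (hdA.deriv hW))) pb₁
  have ho₂ := differentiableOn_of_pullback (h := h₂)
    (f := fun z => h₂ (Complex.log z) / z) hE.isOpen
    ((hdB.mul (hdA.deriv hW)).sub (hdA.mul (hdB.deriv hW))) pb₂
  have rep : ∀ z ∈ Ω \ {0}, Complex.exp (Complex.log z) = z ∧ Complex.exp (Complex.log z) ∈ Ω := by
    rintro z ⟨hz, hz0 : z ≠ 0⟩
    rw [Complex.exp_log hz0]; exact ⟨rfl, hz⟩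
  refine ⟨_, _, _, ⟨hE.isOpen, hE.zero_mem, ho₀, ho₁, ho₂, fun z hz => ?_, fun z hz => ?_,
    fun z hz => ?_, fun z hz => ?_, fun z hz => hE.immersion z hz.1 hz.2⟩, ⟨ho₀, pb₀⟩, ⟨ho₁, pb₁⟩,
    ⟨ho₂, pb₂⟩⟩
  · have := (hE.local_representation (rep z hz).2).2.1
    rwa [(rep z hz).1] at this
  · have := (hE.local_representation (rep z hz).2).1
    rwa [(rep z hz).1] at this
  · have := (hE.local_representation (rep z hz).2).2.2
    rw [(rep z hz).1, neg_div, neg_div] at this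
    exact this
  -- Nullity of the matrix: `det (F' F⁻¹) = det F' / det F = 0`.
  · have e2 := hnull _ (rep z hz).2
    have e3 := hd' _ (rep z hz).2
    simp only [hh₀, hh₁, hh₂]
    generalize Complex.log z = s at *
    linear_combination (1 / z ^ 2) * ((deriv A s * D s - deriv B s * C s) * e3
      - (A s * D s - B s * C s) * e2)

/-! ### Mean curvature -/

theorem killingL_eventuallyEq_fderiv {X : ℂ → ℂ × ℝ} {p q r : ℂ → ℂ} {z : ℂ}
    (hX : ∀ᶠ y in 𝓝 z, HasFDerivAt X (killingL (p y) (q y) (r y) (X y)) y) (b : ℂ) :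
    (fun y => fderiv ℝ X y b) =ᶠ[𝓝 z] fun y => killingL (p y) (q y) (r y) (X y) b := by
  filter_upwards [hX] with y hy using by rw [hy.fderiv]

/-- `X` satisfies a first order system expressing `dX` through `X` and holomorphic coefficients, so
second derivatives follow by differentiating the right-hand side along lines. -/
theorem fderiv_fderiv_eq {X : ℂ → ℂ × ℝ} {p q r : ℂ → ℂ} {p' q' r' z : ℂ}
    (hX : ∀ᶠ y in 𝓝 z, HasFDerivAt X (killingL (p y) (q y) (r y) (X y)) y)
    (h2 : ContDiffAt ℝ 2 X z)
    (hp : HasDerivAt p p' z) (hq : HasDerivAt q q' z) (hr : HasDerivAt r r' z) (a b : ℂ) :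
    fderiv ℝ (fun y => fderiv ℝ X y b) z a =
      (b * (a * r' - 2 * (a * p' * (X z).1 + p z * (killingL (p z) (q z) (r z) (X z) a).1)
          - (a * q' * (X z).1 ^ 2
            + q z * (2 * (X z).1 * (killingL (p z) (q z) (r z) (X z) a).1)))
        + starRingEnd ℂ b * ((2 * (X z).2 * (killingL (p z) (q z) (r z) (X z) a).2 : ℂ)
          * starRingEnd ℂ (q z) + ((X z).2 : ℂ) ^ 2 * starRingEnd ℂ (a * q')),
      -2 * ((killingL (p z) (q z) (r z) (X z) a).2 * (b * (p z + q z * (X z).1)).re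
        + (X z).2 * (b * (a * p' + (a * q' * (X z).1
          + q z * (killingL (p z) (q z) (r z) (X z) a).1))).re)) := by
  have hd : DifferentiableAt ℝ (fun y => fderiv ℝ X y b) z :=
    ((h2.fderiv_right (m := 1) (by norm_num)).differentiableAt (by simp)).clm_apply
      (differentiableAt_const b)
  have hl := hasDerivAt_line hd.hasFDerivAt a
  refine hl.unique ?_
  have hline : Tendsto (fun t : ℝ => z + (t : ℂ) * a) (𝓝 0) (𝓝 z) := by
    have : ContinuousAt (fun t : ℝ => z + (t : ℂ) * a) 0 := by fun_prop
    simpa [ContinuousAt] using this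
  have hev : (fun t : ℝ => fderiv ℝ X (z + t * a) b) =ᶠ[𝓝 0]
      fun t : ℝ => killingL (p (z + t * a)) (q (z + t * a)) (r (z + t * a)) (X (z + t * a)) b :=
    hline.eventually (killingL_eventuallyEq_fderiv hX b)
  refine HasDerivAt.congr_of_eventuallyEq ?_ hev
  have lX := hasDerivAt_line hX.self_of_nhds a
  generalize killingL (p z) (q z) (r z) (X z) a = V at lX ⊢
  simp only [killingL_apply']
  have l1 : HasDerivAt (fun t : ℝ => (X (z + t * a)).1)
      V.1 0 :=
    (ContinuousLinearMap.fst ℝ ℂ ℝ).hasFDerivAt.comp_hasDerivAt 0 lX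
  have l2 : HasDerivAt (fun t : ℝ => (X (z + t * a)).2)
      V.2 0 :=
    (ContinuousLinearMap.snd ℝ ℂ ℝ).hasFDerivAt.comp_hasDerivAt 0 lX
  have l2c := l2.ofReal_comp
  have lp := hasDerivAt_line_of_hasDerivAt hp a
  have lq := hasDerivAt_line_of_hasDerivAt hq a
  have lr := hasDerivAt_line_of_hasDerivAt hr a
  have k1 := ((lr.sub ((lp.const_mul 2).mul l1)).sub (lq.mul (l1.pow 2))).const_mul b
  have k2 := ((l2c.pow 2).mul (hasDerivAt_conj lq)).const_mul (starRingEnd ℂ b)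
  have k3 := ((l2.const_mul (-2)).mul (hasDerivAt_re ((lp.add (lq.mul l1)).const_mul b)))
  refine ((k1.add k2).prodMk k3).congr_deriv ?_
  refine Prod.ext ?_ ?_
  · simp
    ring_nf
    simp
  · simp
    ring

/-- The derivatives `p'`, `q'`, `r'` enter through `ab` or its conjugate, and `1² + i² = 0` removes
them. The rest is algebra in the values of `X`, `p`, `q`, `r`. For a conformal map this equation
says that the mean curvature is one. -/
theorem tension_eq {X : ℂ → ℂ × ℝ} {p q r : ℂ → ℂ} {p' q' r' z : ℂ}
    (hX : ∀ᶠ y in 𝓝 z, HasFDerivAt X (killingL (p y) (q y) (r y) (X y)) y)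
    (h2 : ContDiffAt ℝ 2 X z)
    (hp : HasDerivAt p p' z) (hq : HasDerivAt q q' z) (hr : HasDerivAt r r' z)
    (hm : X z ∈ halfSpace) :
    covDeriv X z 1 1 + covDeriv X z Complex.I Complex.I =
      (2 : ℝ) • hypCross (X z) (fderiv ℝ X z 1) (fderiv ℝ X z Complex.I) := by
  have hw : (X z).2 ≠ 0 := ne_of_gt hm
  simp only [covDeriv, fderiv_fderiv_eq hX h2 hp hq hr, hX.self_of_nhds.fderiv]
  simp only [killingL_apply']
  obtain ⟨k, hkk⟩ : ∃ k, r z - 2 * p z * (X z).1 - q z * (X z).1 ^ 2 = k := ⟨_, rfl⟩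
  obtain ⟨m, hmm⟩ : ∃ m, p z + q z * (X z).1 = m := ⟨_, rfl⟩
  have hpz : p z = m - q z * (X z).1 := by rw [← hmm]; ring
  rw [hkk, hmm] 
  rw [hpz]
  clear hkk hmm hpz hX h2 hp hq hr hm
  generalize q z = q at *
  generalize X z = x at hw ⊢
  obtain ⟨Z, w⟩ := x
  simp only at hw ⊢
  obtain ⟨k1, k2⟩ := k
  obtain ⟨m1, m2⟩ := m
  obtain ⟨q1, q2⟩ := q
  obtain ⟨z1, z2⟩ := Z
  obtain ⟨a1, a2⟩ := p'
  obtain ⟨b1, b2⟩ := q'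
  obtain ⟨c1, c2⟩ := r'
  refine Prod.ext (Complex.ext ?_ ?_) ?_
  · simp [christoffel, hypCross, pow_two]
    field_simp
    ring
  · simp [christoffel, hypCross, pow_two]
    field_simp
    ring
  · simp [christoffel, hypCross, pow_two]
    field_simp
    ring

variable {f₀ f₁ f₂ : ℂ → ℂ}

theorem isOpen_punctured (hΩ : IsOpen Ω) : IsOpen (Ω \ {0}) := hΩ.sdiff isClosed_singleton

theorem IsEndData.tension (h : IsEndData Ω X f₀ f₁ f₂) {z : ℂ} (hz : z ∈ Ω \ {0}) :
    covDeriv X z 1 1 + covDeriv X z Complex.I Complex.I =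
      (2 : ℝ) • hypCross (X z) (fderiv ℝ X z 1) (fderiv ℝ X z Complex.I) := by
  have hn := (isOpen_punctured h.isOpen).mem_nhds hz
  refine tension_eq (p := fun y => -f₁ y) (q := fun y => -f₂ y) (r := f₀) ?_
    (h.contDiffAt z hz 2) (h.holo₁.differentiableAt hn).hasDerivAt.neg
    (h.holo₂.differentiableAt hn).hasDerivAt.neg (h.holo₀.differentiableAt hn).hasDerivAt
    (h.mem z hz)
  filter_upwards [hn] with y hy using h.hasFDerivAt y hy

theorem IsEndData.conformal (h : IsEndData Ω X f₀ f₁ f₂) {z : ℂ} (hz : z ∈ Ω \ {0}) (a b : ℂ) :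
    hypInner (X z) (fderiv ℝ X z a) (fderiv ℝ X z b) =
      (starRingEnd ℂ a * b).re * firstForm X z 1 1 := by
  rw [firstForm, (h.hasFDerivAt z hz).fderiv]
  exact hypInner_killingL (h.null z hz) _ _ _

theorem hypInner_self_pos {x U : ℂ × ℝ} (hx : x ∈ halfSpace) (hU : U ≠ 0) :
    0 < hypInner x U U := by
  have hw : 0 < x.2 := hx
  have e : hypInner x U U = (U.1.re ^ 2 + U.1.im ^ 2 + U.2 ^ 2) / x.2 ^ 2 := by
    simp [hypInner]; ring
  rw [e]
  refine div_pos ?_ (by positivity)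
  by_contra hn
  have h1 : U.1.re = 0 := by nlinarith [sq_nonneg U.1.re, sq_nonneg U.1.im, sq_nonneg U.2]
  have h2 : U.1.im = 0 := by nlinarith [sq_nonneg U.1.re, sq_nonneg U.1.im, sq_nonneg U.2]
  have h3 : U.2 = 0 := by nlinarith [sq_nonneg U.1.re, sq_nonneg U.1.im, sq_nonneg U.2]
  exact hU (Prod.ext (Complex.ext h1 h2) h3)

theorem IsEndData.firstForm_pos (h : IsEndData Ω X f₀ f₁ f₂) {z : ℂ} (hz : z ∈ Ω \ {0}) :
    0 < firstForm X z 1 1 := by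
  refine hypInner_self_pos (h.mem z hz) fun h0 => ?_
  have := h.immersion z hz (h0.trans (map_zero _).symm)
  exact one_ne_zero this

theorem hypInner_add_left (x U V W : ℂ × ℝ) :
    hypInner x (U + V) W = hypInner x U W + hypInner x V W := by
  simp [hypInner]; ring

theorem hypInner_smul_left (x U W : ℂ × ℝ) (c : ℝ) :
    hypInner x (c • U) W = c * hypInner x U W := by
  simp [hypInner]; ring

theorem hypInner_smul_right (x U W : ℂ × ℝ) (c : ℝ) :
    hypInner x U (c • W) = c * hypInner x U W := by
  simp [hypInner]; ring

/-- The mean curvature vector of an end points in the direction of `X_x × X_y`. -/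
theorem IsEndData.meanCurvatureVector_eq (h : IsEndData Ω X f₀ f₁ f₂) {z : ℂ}
    (hz : z ∈ Ω \ {0}) :
    ∃ c : ℝ, 0 < c ∧ meanCurvatureVector X z =
      c • hypCross (X z) (fderiv ℝ X z 1) (fderiv ℝ X z Complex.I) := by
  have hl := h.firstForm_pos hz
  have e1 : firstForm X z 1 Complex.I = 0 := by
    rw [firstForm, h.conformal hz]; simp
  have e2 : firstForm X z Complex.I Complex.I = firstForm X z 1 1 := by
    rw [firstForm, h.conformal hz]; simp
  set N := hypCross (X z) (fderiv ℝ X z 1) (fderiv ℝ X z Complex.I) with hN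
  have hNN : hypInner (X z) N N = firstForm X z 1 1 ^ 2 := by
    rw [hN, hypInner_hypCross_self _ _ _ (h.mem z hz)]
    change firstForm X z 1 1 * firstForm X z Complex.I Complex.I - firstForm X z 1 Complex.I ^ 2 = _
    rw [e1, e2]; ring
  have hnorm : hypNorm (X z) N = firstForm X z 1 1 := by
    rw [hypNorm, hNN, Real.sqrt_sq hl.le]
  -- Conformality gives `|X_x × X_y| = firstForm X z 1 1`, so the normal component of the tension is
  -- twice this number.
  have hs : secondForm X z 1 1 + secondForm X z Complex.I Complex.I = 2 * firstForm X z 1 1 := by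
    rw [secondForm, secondForm, ← hypInner_add_left, h.tension hz, unitNormal, ← hN, hnorm,
      hypInner_smul_left, hypInner_smul_right, hNN]
    field_simp
  have hH : meanCurvature X z = 1 := by
    rw [meanCurvature, e1, e2]
    have : firstForm X z 1 1 * secondForm X z 1 1 - 2 * 0 * secondForm X z 1 Complex.I
        + firstForm X z 1 1 * secondForm X z Complex.I Complex.I =
        2 * (firstForm X z 1 1 * firstForm X z 1 1 - 0 ^ 2) := by
      linear_combination firstForm X z 1 1 * hs
    rw [this]
    exact div_self (by simp [hl.ne'])
  refine ⟨(firstForm X z 1 1)⁻¹, inv_pos.2 hl, ?_⟩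
  rw [meanCurvatureVector, hH, unitNormal, ← hN, hnorm, one_smul]

theorem hypVol_neg_right (x U V W : ℂ × ℝ) : hypVol x U V (-W) = -hypVol x U V W := by
  simp only [hypVol, Matrix.det_fin_three]; simp; ring

theorem hypVol_smul_right (x U V W : ℂ × ℝ) (c : ℝ) :
    hypVol x U V (c • W) = c * hypVol x U V W := by
  simp only [hypVol, Matrix.det_fin_three]; simp; ring

/-- The frame `(dX(a), dX(b), -H)` has the opposite orientation of `(a, b)`. -/
theorem IsEndData.hypVol_meanCurvatureVector (h : IsEndData Ω X f₀ f₁ f₂) {z : ℂ}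
    (hz : z ∈ Ω \ {0}) : ∃ c : ℝ, 0 < c ∧ ∀ a b : ℂ,
    hypVol (X z) (fderiv ℝ X z a) (fderiv ℝ X z b) (-meanCurvatureVector X z) =
      -(c * (starRingEnd ℂ a * b).im) := by
  obtain ⟨c, hc, e⟩ := h.meanCurvatureVector_eq hz
  have hl := h.firstForm_pos hz
  set N := hypCross (X z) (fderiv ℝ X z 1) (fderiv ℝ X z Complex.I) with hN
  have hNN : hypInner (X z) N N = firstForm X z 1 1 ^ 2 := by
    rw [hN, hypInner_hypCross_self _ _ _ (h.mem z hz), h.conformal hz, h.conformal hz,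
      h.conformal hz]
    simp; ring
  refine ⟨c * firstForm X z 1 1 ^ 2, by positivity, fun a b => ?_⟩
  have hv : hypVol (X z) (fderiv ℝ X z 1) (fderiv ℝ X z Complex.I) N = firstForm X z 1 1 ^ 2 := by
    rw [← hNN]; exact (hypInner_hypCross _ _ _ _ (h.mem z hz)).symm
  rw [e, hypVol_neg_right, hypVol_smul_right, hypVol_map, hv]
  ring

/-! ### Orientation of the curve and its conormal -/

theorem hasDerivAt_comp_curve {γ : ℝ → ℂ} {τ : ℝ} (hX : DifferentiableAt ℝ X (γ τ))
    (hγ : DifferentiableAt ℝ γ τ) : velocity X γ τ = fderiv ℝ X (γ τ) (deriv γ τ) :=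
  (hX.hasFDerivAt.comp_hasDerivAt τ hγ.hasDerivAt).deriv

theorem IsEndData.differentiableAt (h : IsEndData Ω X f₀ f₁ f₂) {z : ℂ} (hz : z ∈ Ω \ {0}) :
    DifferentiableAt ℝ X z := (h.hasFDerivAt z hz).differentiableAt

theorem WindsAround.mem {n : ℤ} {γ : ℝ → ℂ} (h : WindsAround Ω n γ) (τ : ℝ) : γ τ ∈ Ω \ {0} := by
  obtain ⟨ρ, -, -, H, -, -, hm, h0, -⟩ := h
  rw [← h0]; exact hm 0 (by simp) τ

/-- The orientation convention forces the curve to wind clockwise, and expresses the conormal. -/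
theorem IsEndData.conormal_eq (h : IsEndData Ω X f₀ f₁ f₂) {γ : ℝ → ℂ} {η : ℝ → ℂ × ℝ}
    {K : ℂ → ℂ × ℝ} (hd : IsFluxData Ω X γ η K) :
    WindsAround Ω (-1) γ ∧ ∀ τ, hypNorm (X (γ τ)) (velocity X γ τ) • η τ =
      -fderiv ℝ X (γ τ) (Complex.I * deriv γ τ) := by
  obtain ⟨n, hn, hw, hη⟩ := hd.conormal
  have hγ : ∀ τ, DifferentiableAt ℝ γ τ := hd.contDiff_curve.differentiable (by simp)
  have hvel : ∀ τ, velocity X γ τ = fderiv ℝ X (γ τ) (deriv γ τ) := fun τ =>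
    hasDerivAt_comp_curve (h.differentiableAt (hw.mem τ)) (hγ τ)
  -- Directness puts `v` on the right of `γ`; the side of the puncture is the right one only for a
  -- clockwise curve.
  have hn1 : n = -1 := by
    refine hn.resolve_left fun hn1 => ?_
    obtain ⟨v, hv, e1, -, -⟩ := hη 0
    obtain ⟨c, hc, e⟩ := h.hypVol_meanCurvatureVector (hw.mem 0)
    have := hd.direct 0
    rw [hvel, e1, e] at this
    rw [hn1] at hv
    simp only [Int.cast_one, one_mul] at hv
    nlinarith [mul_pos hc hv]
  subst hn1
  refine ⟨hw, fun τ => ?_⟩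
  obtain ⟨v, hv, e1, e2, e3⟩ := hη τ
  have hz := hw.mem τ
  have hl := h.firstForm_pos hz
  rw [hvel] at e2 ⊢
  rw [e1] at e2 e3
  rw [h.conformal hz] at e2 e3
  rw [hypNorm, h.conformal hz, e1, ← map_smul, ← map_neg]
  congr 1
  set u := deriv γ τ with hu
  set l := firstForm X (γ τ) 1 1
  have hu0 : u ≠ 0 := hd.regular τ
  have e2' : (starRingEnd ℂ v * u).re = 0 := (mul_eq_zero.1 e2).resolve_right hl.ne'
  obtain ⟨u1, u2⟩ := u
  obtain ⟨v1, v2⟩ := v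
  simp at hv e2' e3
  have hpos : 0 < u1 ^ 2 + u2 ^ 2 := by
    by_contra hneg
    exact hu0 (Complex.ext (by simp; nlinarith [sq_nonneg u1, sq_nonneg u2])
      (by simp; nlinarith [sq_nonneg u1, sq_nonneg u2]))
  -- Orthogonality and `d` determine `v = d · iu / |u|²`; unit length then gives `d² l = |u|²`, and
  -- `d < 0` selects the root `-d l` for the norm of the velocity.
  set d := u1 * v2 - u2 * v1 with hdd
  have hdneg : d < 0 := by rw [hdd]; linarith
  have hv1 : (u1 ^ 2 + u2 ^ 2) * v1 = -d * u2 := by rw [hdd]; linear_combination u1 * e2'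
  have hv2 : (u1 ^ 2 + u2 ^ 2) * v2 = d * u1 := by rw [hdd]; linear_combination u2 * e2'
  have hd2 : d ^ 2 * l = u1 ^ 2 + u2 ^ 2 := by
    rw [hdd]; linear_combination (u1 ^ 2 + u2 ^ 2) * e3 - l * (v1 * u1 + v2 * u2) * e2'
  have hsq : Real.sqrt ((starRingEnd ℂ (⟨u1, u2⟩ : ℂ) * ⟨u1, u2⟩).re * l) = -d * l := by
    rw [show (starRingEnd ℂ (⟨u1, u2⟩ : ℂ) * ⟨u1, u2⟩).re * l = (-d * l) ^ 2 by
      simp; linear_combination (-l) * hd2]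
    exact Real.sqrt_sq (by nlinarith)
  rw [hsq]
  apply Complex.ext
  · simp
    apply mul_left_cancel₀ hpos.ne'
    linear_combination (-d * l) * hv1 + u2 * hd2
  · simp
    apply mul_left_cancel₀ hpos.ne'
    linear_combination (d * l) * hv2 + u1 * hd2

/-! ### Stokes' theorem on cylinders and disks -/

/-- Stokes' theorem for the pull-back of a one-form to a cylinder `[0, 1] × ℝ / 2πℤ`. -/
theorem integral_cylinder {E F : Type*} [NormedAddCommGroup E] [NormedSpace ℝ E]
    [NormedAddCommGroup F] [NormedSpace ℝ F] [CompleteSpace F]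
    {L : ℝ × ℝ → E} (hL : ContDiff ℝ 2 L)
    (hper : ∀ r τ, L (r, τ + 2 * Real.pi) = L (r, τ)) {β : E → E →L[ℝ] F} {U : Set E}
    (hU : IsOpen U) (hβ : ContDiffOn ℝ 1 β U) (hm : ∀ r ∈ Icc (0 : ℝ) 1, ∀ τ, L (r, τ) ∈ U) :
    ∫ x in Icc ((0 : ℝ), -Real.pi) (1, Real.pi),
        (fderiv ℝ β (L x) (fderiv ℝ L x (1, 0)) (fderiv ℝ L x (0, 1))
          - fderiv ℝ β (L x) (fderiv ℝ L x (0, 1)) (fderiv ℝ L x (1, 0))) =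
      (∫ τ in (-Real.pi)..Real.pi, β (L (1, τ)) (fderiv ℝ L (1, τ) (0, 1)))
        - ∫ τ in (-Real.pi)..Real.pi, β (L (0, τ)) (fderiv ℝ L (0, τ) (0, 1)) := by
  have hpi : -Real.pi ≤ Real.pi := by linarith [Real.pi_pos]
  have hmem : ∀ x ∈ Icc ((0 : ℝ), -Real.pi) (1, Real.pi), L x ∈ U := fun x hx =>
    hm x.1 ⟨hx.1.1, hx.2.1⟩ x.2
  have hLd : ∀ x, HasFDerivAt L (fderiv ℝ L x) x := fun x =>
    (hL.differentiable (by simp) x).hasFDerivAt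
  have hL1 : ContDiff ℝ 1 (fderiv ℝ L) := hL.fderiv_right (by norm_num)
  have hL2 : ∀ x, HasFDerivAt (fderiv ℝ L) (fderiv ℝ (fderiv ℝ L) x) x := fun x =>
    (hL1.differentiable (by simp) x).hasFDerivAt
  have hLv : ∀ v x, HasFDerivAt (fun y => fderiv ℝ L y v)
      ((fderiv ℝ (fderiv ℝ L) x).flip v) x := fun v x => by
    simpa using (hL2 x).clm_apply (hasFDerivAt_const v x)
  have hcv : ∀ v, Continuous (fun y => fderiv ℝ L y v) := fun v =>
    hL1.continuous.clm_apply continuous_const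
  have hβd : ∀ x ∈ Icc ((0 : ℝ), -Real.pi) (1, Real.pi),
      HasFDerivAt (fun y => β (L y)) ((fderiv ℝ β (L x)).comp (fderiv ℝ L x)) x := fun x hx =>
    ((hβ.differentiableOn (by simp)).differentiableAt
      (hU.mem_nhds (hmem x hx))).hasFDerivAt.comp x (hLd x)
  have hd : ∀ v, ∀ x ∈ Icc ((0 : ℝ), -Real.pi) (1, Real.pi),
      HasFDerivAt (fun y => β (L y) (fderiv ℝ L y v))
        ((β (L x)).comp ((fderiv ℝ (fderiv ℝ L) x).flip v)
          + ((fderiv ℝ β (L x)).comp (fderiv ℝ L x)).flip (fderiv ℝ L x v)) x := fun v x hx =>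
    (hβd x hx).clm_apply (hLv v x)
  -- By this symmetry the second derivatives of `L` drop out of the divergence, leaving only `dβ`.
  have hsymm : ∀ x, fderiv ℝ (fderiv ℝ L) x (1, 0) (0, 1) =
      fderiv ℝ (fderiv ℝ L) x (0, 1) (1, 0) := fun x =>
    (hL.contDiffAt.isSymmSndFDerivAt (by simp)) _ _
  have hcont : ContinuousOn (fun x =>
      (fderiv ℝ β (L x) (fderiv ℝ L x (1, 0)) (fderiv ℝ L x (0, 1))
          - fderiv ℝ β (L x) (fderiv ℝ L x (0, 1)) (fderiv ℝ L x (1, 0))))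
      (Icc ((0 : ℝ), -Real.pi) (1, Real.pi)) := by
    have h1 : ContinuousOn (fun x => fderiv ℝ β (L x)) (Icc ((0 : ℝ), -Real.pi) (1, Real.pi)) :=
      (hβ.continuousOn_fderiv_of_isOpen hU (by simp)).comp hL.continuous.continuousOn hmem
    exact ((h1.clm_apply (hcv _).continuousOn).clm_apply (hcv _).continuousOn).sub
      ((h1.clm_apply (hcv _).continuousOn).clm_apply (hcv _).continuousOn)
  have key := integral_divergence_prod_Icc_of_hasFDerivAt_of_le
    (fun y => β (L y) (fderiv ℝ L y (0, 1))) (fun y => -β (L y) (fderiv ℝ L y (1, 0)))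
    (fun x => (β (L x)).comp ((fderiv ℝ (fderiv ℝ L) x).flip (0, 1))
          + ((fderiv ℝ β (L x)).comp (fderiv ℝ L x)).flip (fderiv ℝ L x (0, 1)))
    (fun x => -((β (L x)).comp ((fderiv ℝ (fderiv ℝ L) x).flip (1, 0))
          + ((fderiv ℝ β (L x)).comp (fderiv ℝ L x)).flip (fderiv ℝ L x (1, 0))))
    ((0 : ℝ), -Real.pi) (1, Real.pi) ⟨zero_le_one, hpi⟩
    (fun x hx => (hd _ x hx).continuousAt.continuousWithinAt)
    (fun x hx => (hd _ x hx).neg.continuousAt.continuousWithinAt)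
    (fun x hx => hd _ x ⟨⟨hx.1.1.le, hx.2.1.le⟩, ⟨hx.1.2.le, hx.2.2.le⟩⟩)
    (fun x hx => (hd _ x ⟨⟨hx.1.1.le, hx.2.1.le⟩, ⟨hx.1.2.le, hx.2.2.le⟩⟩).neg)
  have hint : (fun x => (((β (L x)).comp ((fderiv ℝ (fderiv ℝ L) x).flip (0, 1))
          + ((fderiv ℝ β (L x)).comp (fderiv ℝ L x)).flip (fderiv ℝ L x (0, 1))) : ℝ × ℝ →L[ℝ] F)
          ((1 : ℝ), (0 : ℝ)) + (-((β (L x)).comp ((fderiv ℝ (fderiv ℝ L) x).flip (1, 0))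
          + ((fderiv ℝ β (L x)).comp (fderiv ℝ L x)).flip (fderiv ℝ L x (1, 0))) : ℝ × ℝ →L[ℝ] F)
          ((0 : ℝ), (1 : ℝ))) =
      fun x => (fderiv ℝ β (L x) (fderiv ℝ L x (1, 0)) (fderiv ℝ L x (0, 1))
          - fderiv ℝ β (L x) (fderiv ℝ L x (0, 1)) (fderiv ℝ L x (1, 0))) := by
    funext x
    simp only [add_apply, neg_apply,
      ContinuousLinearMap.comp_apply, ContinuousLinearMap.flip_apply, hsymm]
    abel
  rw [hint] at key
  rw [key (hcont.integrableOn_compact isCompact_Icc)]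
  -- The edges `τ = π` and `τ = -π` have the same image, so their contributions cancel.
  have hperd : ∀ r, fderiv ℝ L (r, Real.pi) = fderiv ℝ L (r, -Real.pi) := fun r => by
    have h1 : (fun x => L (x + (0, 2 * Real.pi))) = L := by
      funext x; rw [← hper x.1 x.2]; congr 1; ext <;> simp
    have h2 := fderiv_comp_add_right (𝕜 := ℝ) (f := L) (x := (r, -Real.pi)) (0, 2 * Real.pi)
    rw [h1] at h2
    rw [h2]
    congr 1
    ext <;> simp
    ring
  have hLp : ∀ r, L (r, Real.pi) = L (r, -Real.pi) := fun r => by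
    rw [← hper r (-Real.pi)]; congr 2; ring
  simp only [hperd, hLp, sub_self, zero_add]

/-- Turns the disk into the box of the divergence theorem; the extra edges of the closed box are
null sets. -/
theorem integral_closedBall_eq_polar {F : Type*} [NormedAddCommGroup F] [NormedSpace ℝ F]
    (h : ℂ → F) :
    ∫ z in Metric.closedBall (0 : ℂ) 1, h z =
      ∫ x in Icc ((0 : ℝ), -Real.pi) (1, Real.pi), x.1 • h (x.1 * Complex.exp (x.2 * Complex.I)) := by
  rw [← integral_indicator Metric.isClosed_closedBall.measurableSet,
    ← Complex.integral_comp_polarCoord_symm]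
  have e : ∀ p : ℝ × ℝ, Complex.polarCoord.symm p = p.1 * Complex.exp (p.2 * Complex.I) :=
    fun p => by rw [Complex.polarCoord_symm_apply, Complex.exp_mul_I]; simp
  have hae : (Icc ((0 : ℝ), -Real.pi) (1, Real.pi) : Set (ℝ × ℝ)) =ᵐ[volume]
      Ioc (0 : ℝ) 1 ×ˢ Ioo (-Real.pi) Real.pi := by
    rw [← Icc_prod_Icc]
    exact Measure.set_prod_ae_eq Ioc_ae_eq_Icc.symm Ioo_ae_eq_Icc.symm
  rw [setIntegral_congr_set hae]
  have hsub : Ioc (0 : ℝ) 1 ×ˢ Ioo (-Real.pi) Real.pi ⊆ polarCoord.target := by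
    rintro ⟨r, t⟩ ⟨hr, ht⟩
    exact ⟨hr.1, ht⟩
  rw [setIntegral_eq_of_subset_of_forall_sdiff_eq_zero
    polarCoord.open_target.measurableSet hsub]
  · refine setIntegral_congr_fun (measurableSet_Ioc.prod measurableSet_Ioo) ?_
    rintro ⟨r, t⟩ ⟨hr, ht⟩
    simp only [e]
    rw [indicator_of_mem]
    simpa [abs_of_pos hr.1] using hr.2
  · rintro ⟨r, t⟩ ⟨hrt, hn⟩
    have hr : 0 < r := hrt.1
    have ht : t ∈ Ioo (-Real.pi) Real.pi := hrt.2
    rw [indicator_of_notMem, smul_zero]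
    intro hmem
    rw [e] at hmem
    have : r ≤ 1 := by simpa [abs_of_pos hr] using hmem
    exact hn ⟨⟨hr, this⟩, ht⟩

theorem isOpen_halfSpace : IsOpen halfSpace := isOpen_lt continuous_const continuous_snd

/-- `fluxForm` as a field of linear forms. -/
noncomputable def fluxFormL (P Q R : ℂ) (x : ℂ × ℝ) : ℂ × ℝ →L[ℝ] ℝ :=
  (Complex.imCLM (Q + ((x.2 : ℂ) ^ 2)⁻¹ * (R - 2 * P * x.1 - Q * x.1 ^ 2))) •
      Complex.reCLM.comp (ContinuousLinearMap.fst ℝ ℂ ℝ)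
    + (Complex.reCLM (Q - ((x.2 : ℂ) ^ 2)⁻¹ * (R - 2 * P * x.1 - Q * x.1 ^ 2))) •
      Complex.imCLM.comp (ContinuousLinearMap.fst ℝ ℂ ℝ)
    + (-2 * x.2⁻¹ * Complex.imCLM (P + Q * x.1)) • ContinuousLinearMap.snd ℝ ℂ ℝ

theorem fluxFormL_apply (P Q R : ℂ) (x V : ℂ × ℝ) :
    fluxFormL P Q R x V = fluxForm P Q R x V := by
  simp only [fluxFormL, fluxForm]
  rw [div_eq_mul_inv, mul_comm (R - 2 * P * x.1 - Q * x.1 ^ 2)]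
  generalize ((x.2 : ℂ) ^ 2)⁻¹ * (R - 2 * P * x.1 - Q * x.1 ^ 2) = k
  simp
  ring

theorem contDiffOn_fluxFormL (P Q R : ℂ) : ContDiffOn ℝ 1 (fluxFormL P Q R) halfSpace := by
  have h2 : ContDiffOn ℝ 1 (fun x : ℂ × ℝ => (x.2 : ℂ)) halfSpace :=
    (Complex.ofRealCLM.contDiff.comp contDiff_snd).contDiffOn
  have hk : ContDiffOn ℝ 1
      (fun x : ℂ × ℝ => ((x.2 : ℂ) ^ 2)⁻¹ * (R - 2 * P * x.1 - Q * x.1 ^ 2)) halfSpace := by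
    refine ContDiffOn.mul ((h2.pow 2).inv fun x hx => ?_) (by fun_prop)
    have : x.2 ≠ 0 := ne_of_gt hx
    exact pow_ne_zero 2 (by exact_mod_cast this)
  refine ContDiffOn.add (ContDiffOn.add ?_ ?_) ?_
  · exact (Complex.imCLM.contDiff.comp_contDiffOn (contDiffOn_const.add hk)).smul contDiffOn_const
  · exact (Complex.reCLM.contDiff.comp_contDiffOn (contDiffOn_const.sub hk)).smul contDiffOn_const
  · refine ContDiffOn.smul (ContDiffOn.mul (contDiffOn_const.mul
      (contDiff_snd.contDiffOn.inv fun x hx => ne_of_gt hx)) ?_) contDiffOn_const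
    exact Complex.imCLM.contDiff.comp_contDiffOn (by fun_prop)

/-- Obtained by differentiating `fluxForm` at a fixed tangent vector `V` along the line through `x`
in direction `U`. -/
theorem fderiv_fluxFormL (P Q R : ℂ) {x : ℂ × ℝ} (hx : x ∈ halfSpace) (U V : ℂ × ℝ) :
    fderiv ℝ (fluxFormL P Q R) x U V =
      (starRingEnd ℂ V.1 * (((-(2 * P * U.1) - Q * (2 * x.1 * U.1)) * (x.2 : ℂ) ^ 2
          - (R - 2 * P * x.1 - Q * x.1 ^ 2) * (2 * x.2 * U.2)) / ((x.2 : ℂ) ^ 2) ^ 2)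
        - 2 * ((-(V.2 * U.2) / x.2 ^ 2 : ℝ) * (P + Q * x.1) + (V.2 / x.2 : ℝ) * (Q * U.1))).im := by
  have hw : x.2 ≠ 0 := ne_of_gt hx
  have hd : HasFDerivAt (fluxFormL P Q R) (fderiv ℝ (fluxFormL P Q R) x) x :=
    (((contDiffOn_fluxFormL P Q R).differentiableOn (by simp)).differentiableAt
      (isOpen_halfSpace.mem_nhds hx)).hasFDerivAt
  have l1 : HasDerivAt (fun t : ℝ => x.1 + (t : ℂ) * U.1) U.1 0 := by
    simpa using ((Complex.ofRealCLM.hasDerivAt (x := (0 : ℝ))).mul_const U.1).const_add x.1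
  have l2 : HasDerivAt (fun t : ℝ => x.2 + t * U.2) U.2 0 := by
    simpa using ((hasDerivAt_id (0 : ℝ)).mul_const U.2).const_add x.2
  have l2c := l2.ofReal_comp
  have lx : HasDerivAt (fun t : ℝ => (x.1 + (t : ℂ) * U.1, x.2 + t * U.2)) U 0 := l1.prodMk l2
  have hd' : HasFDerivAt (fun y => fluxForm P Q R y V) ((fderiv ℝ (fluxFormL P Q R) x).flip V)
      (x.1 + ((0 : ℝ) : ℂ) * U.1, x.2 + 0 * U.2) := by
    have := hd.clm_apply (hasFDerivAt_const V x)
    simpa [fluxFormL_apply] using this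
  have h1 : HasDerivAt (fun t : ℝ => fluxForm P Q R (x.1 + (t : ℂ) * U.1, x.2 + t * U.2) V)
      (fderiv ℝ (fluxFormL P Q R) x U V) 0 :=
    HasFDerivAt.comp_hasDerivAt (f := fun t : ℝ => (x.1 + (t : ℂ) * U.1, x.2 + t * U.2)) (0 : ℝ)
      hd' lx
  refine h1.unique ?_
  have k1 := (((l1.const_mul (2 * P)).const_sub R).sub ((l1.pow 2).const_mul Q)).div (l2c.pow 2)
    (by simpa using hw)
  have k2 := ((((hasDerivAt_const (0 : ℝ) V.2).div l2 (by simpa using hw)).ofReal_comp.const_mul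
    2).mul ((l1.const_mul Q).const_add P))
  have k3 := ((k1.const_mul (starRingEnd ℂ V.1)).add_const (Q * V.1)).sub k2
  refine (Complex.imCLM.hasFDerivAt.comp_hasDerivAt 0 k3).congr_deriv ?_
  rw [Complex.imCLM_apply]
  congr 1
  simp
  ring

/-- This makes `fluxForm` a potential for the disk term of the flux, with the factor `2` matching
mean curvature one. -/
theorem exteriorDerivative_fluxFormL (P Q R : ℂ) {x : ℂ × ℝ} (hx : x ∈ halfSpace)
    (U V : ℂ × ℝ) :
    fderiv ℝ (fluxFormL P Q R) x U V - fderiv ℝ (fluxFormL P Q R) x V U =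
      -2 * hypVol x U V (killing P Q R x) := by
  rw [fderiv_fluxFormL P Q R hx, fderiv_fluxFormL P Q R hx]
  have hw : x.2 ≠ 0 := ne_of_gt hx
  have hwc : ((x.2 : ℂ) ^ 2) ^ 2 = ((x.2 ^ 4 : ℝ) : ℂ) := by push_cast; ring
  simp only [hwc, hypVol, Matrix.det_fin_three, killing]
  obtain ⟨⟨z1, z2⟩, w⟩ := x
  obtain ⟨P1, P2⟩ := P
  obtain ⟨Q1, Q2⟩ := Q
  obtain ⟨R1, R2⟩ := R
  obtain ⟨⟨u1, u2⟩, u3⟩ := U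
  obtain ⟨⟨v1, v2⟩, v3⟩ := V
  simp only [Complex.div_ofReal_im, Complex.div_ofReal_re, Complex.sub_im,
    Complex.add_im, Complex.neg_re, Complex.neg_im,
    Complex.mul_im, Complex.mul_re, Complex.sub_re, Complex.add_re, Complex.conj_re, Complex.conj_im,
    Complex.ofReal_re, Complex.ofReal_im, pow_two, Complex.re_ofNat, Complex.im_ofNat] at hw ⊢
  simp
  field_simp
  ring

/-- The normalisation cancels against the area density. Where `K` is not immersed both sides vanish.
-/
theorem diskNormal_smul (K : ℂ → ℂ × ℝ) {z : ℂ} (hK : K z ∈ halfSpace) (Y : ℂ × ℝ) :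
    hypInner (K z) (diskNormal K z) Y * hypNorm (K z) (diskCross K z) =
      hypVol (K z) (fderiv ℝ K z 1) (fderiv ℝ K z Complex.I) Y := by
  rw [diskNormal, hypInner_smul_left, ← hypInner_hypCross _ _ _ _ hK, ← diskCross]
  by_cases h : diskCross K z = 0
  · simp [h, hypInner]
  · have : hypNorm (K z) (diskCross K z) ≠ 0 := (Real.sqrt_pos.2 (hypInner_self_pos hK h)).ne'
    field_simp

theorem hasDerivAt_exp_mul_I (τ : ℝ) : HasDerivAt (fun τ : ℝ => Complex.exp (τ * Complex.I))
    (Complex.I * Complex.exp (τ * Complex.I)) τ := by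
  have := ((Complex.ofRealCLM.hasDerivAt (x := τ)).mul_const Complex.I).cexp
  simpa [mul_comm] using this

/-- Stokes' theorem for the disk `K` and the form `fluxForm`. -/
theorem integral_disk (P Q R : ℂ) {K : ℂ → ℂ × ℝ} (hK : ContDiff ℝ 2 K)
    (hm : ∀ z ∈ Metric.closedBall (0 : ℂ) 1, K z ∈ halfSpace) :
    -2 * ∫ z in Metric.closedBall (0 : ℂ) 1,
        hypVol (K z) (fderiv ℝ K z 1) (fderiv ℝ K z Complex.I) (killing P Q R (K z)) =
      ∫ τ in (-Real.pi)..Real.pi, fluxForm P Q R (K (Complex.exp (τ * Complex.I)))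
        (deriv (fun τ : ℝ => K (Complex.exp (τ * Complex.I))) τ) := by
  set L : ℝ × ℝ → ℂ × ℝ := fun x => K (x.1 * Complex.exp (x.2 * Complex.I)) with hL
  have hpol : ContDiff ℝ 2 (fun x : ℝ × ℝ => (x.1 : ℂ) * Complex.exp (x.2 * Complex.I)) := by
    have h1 : ContDiff ℝ 2 (fun x : ℝ × ℝ => (x.1 : ℂ)) := Complex.ofRealCLM.contDiff.comp contDiff_fst
    have h2 : ContDiff ℝ 2 (fun x : ℝ × ℝ => (x.2 : ℂ)) := Complex.ofRealCLM.contDiff.comp contDiff_snd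
    exact h1.mul (h2.mul contDiff_const).cexp
  have hLc : ContDiff ℝ 2 L := hK.comp hpol
  have hdK : ∀ z, HasFDerivAt K (fderiv ℝ K z) z := fun z =>
    (hK.differentiable (by simp) z).hasFDerivAt
  have hLd : ∀ x, HasFDerivAt L (fderiv ℝ L x) x := fun x =>
    (hLc.differentiable (by simp) x).hasFDerivAt
  have hLr : ∀ x : ℝ × ℝ, fderiv ℝ L x (1, 0) =
      fderiv ℝ K (x.1 * Complex.exp (x.2 * Complex.I)) (Complex.exp (x.2 * Complex.I)) := by
    rintro ⟨r, t⟩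
    have h1 : HasDerivAt (fun s : ℝ => (s, t)) ((1 : ℝ), (0 : ℝ)) r :=
      (hasDerivAt_id r).prodMk (hasDerivAt_const r t)
    have h2 : HasDerivAt (fun s : ℝ => (s : ℂ) * Complex.exp (t * Complex.I))
        (Complex.exp (t * Complex.I)) r := by
      simpa using (Complex.ofRealCLM.hasDerivAt (x := r)).mul_const (Complex.exp (t * Complex.I))
    exact ((hLd (r, t)).comp_hasDerivAt r h1).unique ((hdK _).comp_hasDerivAt r h2)
  have hcurve : ∀ r t : ℝ, HasDerivAt (fun s : ℝ => (r : ℂ) * Complex.exp (s * Complex.I))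
      ((r : ℂ) * (Complex.I * Complex.exp (t * Complex.I))) t := fun r t =>
    (hasDerivAt_exp_mul_I t).const_mul (r : ℂ)
  have hLt' : ∀ r t : ℝ, HasDerivAt (fun s : ℝ => L (r, s)) (fderiv ℝ L (r, t) (0, 1)) t := by
    intro r t
    exact (hLd (r, t)).comp_hasDerivAt t ((hasDerivAt_const t r).prodMk (hasDerivAt_id t))
  have hLt : ∀ x : ℝ × ℝ, fderiv ℝ L x (0, 1) =
      fderiv ℝ K (x.1 * Complex.exp (x.2 * Complex.I))
        (x.1 * (Complex.I * Complex.exp (x.2 * Complex.I))) := by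
    rintro ⟨r, t⟩
    exact (hLt' r t).unique ((hdK _).comp_hasDerivAt t (hcurve r t))
  have hball : ∀ r ∈ Icc (0 : ℝ) 1, ∀ t : ℝ,
      (r : ℂ) * Complex.exp (t * Complex.I) ∈ Metric.closedBall (0 : ℂ) 1 := by
    intro r hr t
    simpa [Complex.norm_exp_ofReal_mul_I, abs_of_nonneg hr.1] using hr.2
  have key := integral_cylinder hLc (fun r t => by
      simp only [hL]
      congr 2
      rw [show ((t + 2 * Real.pi : ℝ) : ℂ) * Complex.I = t * Complex.I + 2 * Real.pi * Complex.I by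
        push_cast; ring, Complex.exp_periodic])
    isOpen_halfSpace (contDiffOn_fluxFormL P Q R) (fun r hr t => hm _ (hball r hr t))
  -- The circle `r = 0` collapses to the centre of the disk, so its velocity is zero.
  have h0 : (∫ τ in (-Real.pi)..Real.pi,
      fluxFormL P Q R (L (0, τ)) (fderiv ℝ L (0, τ) (0, 1))) = 0 := by
    simp [hLt]
  have h1 : ∀ τ : ℝ, fluxFormL P Q R (L (1, τ)) (fderiv ℝ L (1, τ) (0, 1)) =
      fluxForm P Q R (K (Complex.exp (τ * Complex.I)))
        (deriv (fun τ : ℝ => K (Complex.exp (τ * Complex.I))) τ) := by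
    intro τ
    rw [fluxFormL_apply, ← (hLt' 1 τ).deriv]
    simp [hL]
  rw [h0, sub_zero] at key
  simp only [h1] at key
  rw [← key, integral_closedBall_eq_polar, ← integral_const_mul]
  refine setIntegral_congr_fun measurableSet_Icc ?_
  rintro ⟨r, t⟩ ht
  have hr : r ∈ Icc (0 : ℝ) 1 := ⟨ht.1.1, ht.2.1⟩
  simp only
  rw [exteriorDerivative_fluxFormL P Q R (hm _ (hball r hr t)), hLr, hLt]
  have him : (starRingEnd ℂ (Complex.exp (t * Complex.I))
      * (r * (Complex.I * Complex.exp (t * Complex.I)))).im = r := by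
    have : starRingEnd ℂ (Complex.exp (t * Complex.I)) * Complex.exp (t * Complex.I) = 1 := by
      rw [Complex.conj_mul', Complex.norm_exp_ofReal_mul_I]; simp
    rw [show starRingEnd ℂ (Complex.exp (t * Complex.I))
      * (r * (Complex.I * Complex.exp (t * Complex.I))) = r * Complex.I by
        linear_combination (r * Complex.I) * this]
    simp
  simp only
  rw [hypVol_map _ _ _ (Complex.exp (t * Complex.I)), him, smul_eq_mul]

/-! ### Killing fields of translations -/

/-- The map `poincareExtension` is onto the half-space. -/
theorem exists_poincareExtension_eq (P : GL (Fin 2) ℂ) {x : ℂ × ℝ} (hx : x ∈ halfSpace) :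
    ∃ p ∈ halfSpace, poincareExtension P p = x := by
  have hδ : P 0 0 * P 1 1 - P 0 1 * P 1 0 ≠ 0 := by
    rw [← Matrix.det_fin_two]; exact P.det_ne_zero
  simp only [poincareExtension]
  generalize P 0 0 = a at *
  generalize P 0 1 = b at *
  generalize P 1 0 = c at *
  generalize P 1 1 = d at *
  obtain ⟨ζ, w⟩ := x
  have hw : 0 < w := hx
  set δ := a * d - b * c with hδd
  set k := a - c * ζ with hk
  have hΔ : 0 < ‖k‖ ^ 2 + ‖c‖ ^ 2 * w ^ 2 := by
    by_cases hc : c = 0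
    · have : k ≠ 0 := by
        rw [hk, hc]; rintro h; apply hδ; rw [hδd, hc]; simp at h; simp [h]
      have := norm_pos_iff.2 this
      positivity
    · have := norm_pos_iff.2 hc
      positivity
  set Δ : ℝ := ‖k‖ ^ 2 + ‖c‖ ^ 2 * w ^ 2 with hΔd
  have hδn : 0 < ‖δ‖ := norm_pos_iff.2 hδ
  have hΔc : (Δ : ℂ) = k * starRingEnd ℂ k + c * starRingEnd ℂ c * w ^ 2 := by
    rw [Complex.mul_conj', Complex.mul_conj', hΔd]; push_cast; ring
  have hΔ0 : (Δ : ℂ) ≠ 0 := by exact_mod_cast hΔ.ne'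
  have hδc : ((‖δ‖ : ℝ) : ℂ) ^ 2 = δ * starRingEnd ℂ δ := (Complex.mul_conj' δ).symm
  -- The preimage is the Poincaré extension of the inverse matrix, proportional to `(d, -b; -c, a)`,
  -- applied to `(ζ, w)`.
  set z : ℂ := ((d * ζ - b) * starRingEnd ℂ k - d * starRingEnd ℂ c * w ^ 2) / Δ with hz
  have e1 : c * z + d = starRingEnd ℂ k * δ / Δ := by
    rw [hz]; field_simp; rw [hΔc, hδd, hk]; ring
  have e2 : a * z + b = δ * (starRingEnd ℂ k * ζ - starRingEnd ℂ c * w ^ 2) / Δ := by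
    rw [hz]; field_simp; rw [hΔc, hδd]
    linear_combination (b * starRingEnd ℂ k) * hk
  have e3 : ‖c * z + d‖ ^ 2 + ‖c‖ ^ 2 * (‖δ‖ * w / Δ) ^ 2 = ‖δ‖ ^ 2 / Δ := by
    rw [e1, norm_div, norm_mul, Complex.norm_conj, Complex.norm_real, Real.norm_eq_abs,
      abs_of_pos hΔ]
    have : ‖k‖ ^ 2 = Δ - ‖c‖ ^ 2 * w ^ 2 := by rw [hΔd]; ring
    field_simp
    linear_combination this
  refine ⟨(z, ‖δ‖ * w / Δ), div_pos (mul_pos hδn hw) hΔ, ?_⟩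
  simp only
  rw [e3]
  refine Prod.ext ?_ ?_
  · simp only
    rw [e2, e1]
    push_cast
    have hδ' : starRingEnd ℂ δ ≠ 0 := by simpa using hδ
    simp only [div_pow, mul_pow, map_div₀, map_mul, Complex.conj_conj, Complex.conj_ofReal, hδc]
    field_simp
    rw [hΔc, hk]
    ring
  · simp only
    field_simp

/-- The dilation flow is conjugated by `P`. The resulting quadratic polynomial `R - 2Pζ - Qζ²` is
`-(cζ - a)(dζ - b) / δ`, with zeros at the images `a / c` of `∞` and `b / d` of `0`. -/
theorem poincareExtension_hasDerivAt (P : GL (Fin 2) ℂ) {p : ℂ × ℝ} (hp : p ∈ halfSpace) :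
    HasDerivAt (fun t : ℝ => poincareExtension P (Real.exp t • p))
      (killing (-(P 0 0 * P 1 1 + P 0 1 * P 1 0) / (2 * (P 0 0 * P 1 1 - P 0 1 * P 1 0)))
        (P 1 0 * P 1 1 / (P 0 0 * P 1 1 - P 0 1 * P 1 0))
        (-(P 0 0 * P 0 1) / (P 0 0 * P 1 1 - P 0 1 * P 1 0)) (poincareExtension P p)) 0 := by
  have hδ : P 0 0 * P 1 1 - P 0 1 * P 1 0 ≠ 0 := by
    rw [← Matrix.det_fin_two]; exact P.det_ne_zero
  simp only [poincareExtension]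
  generalize P 0 0 = a at *
  generalize P 0 1 = b at *
  generalize P 1 0 = c at *
  generalize P 1 1 = d at *
  obtain ⟨ζ, w⟩ := p
  have hw : 0 < w := hp
  have hΔ : 0 < ‖c * ζ + d‖ ^ 2 + ‖c‖ ^ 2 * w ^ 2 := by
    by_cases hc : c = 0
    · have : d ≠ 0 := by rintro rfl; simp [hc] at hδ
      have := norm_pos_iff.2 this
      simp only [hc, zero_mul, zero_add]
      positivity
    · have := norm_pos_iff.2 hc
      positivity
  have nsq : ∀ z : ℂ, ((‖z‖ : ℝ) : ℂ) ^ 2 = z * starRingEnd ℂ z := fun z =>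
    (Complex.mul_conj' z).symm
  have hre : ∀ (z u : ℂ) (v : ℝ), ‖z‖ ^ 2 + ‖u‖ ^ 2 * v ^ 2
      = (z * starRingEnd ℂ z + u * starRingEnd ℂ u * (v : ℂ) ^ 2).re := by
    intro z u v
    rw [← nsq, ← nsq, ← Complex.ofReal_pow, ← Complex.ofReal_pow, ← Complex.ofReal_pow,
      ← Complex.ofReal_mul, ← Complex.ofReal_add, Complex.ofReal_re]
  have hcx : ∀ (z u : ℂ) (v : ℝ), ((‖z‖ ^ 2 + ‖u‖ ^ 2 * v ^ 2 : ℝ) : ℂ)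
      = z * starRingEnd ℂ z + u * starRingEnd ℂ u * (v : ℂ) ^ 2 := by
    intro z u v
    push_cast
    rw [nsq, nsq]
  have le : HasDerivAt (fun t : ℝ => (Real.exp t : ℂ)) 1 0 := by
    simpa using (Real.hasDerivAt_exp 0).ofReal_comp
  have lζ : HasDerivAt (fun t : ℝ => (Real.exp t : ℂ) * ζ) ζ 0 := by simpa using le.mul_const ζ
  have lw : HasDerivAt (fun t : ℝ => ((Real.exp t * w : ℝ) : ℂ)) w 0 := by
    simpa using ((Real.hasDerivAt_exp 0).mul_const w).ofReal_comp
  have lwr : HasDerivAt (fun t : ℝ => Real.exp t * w) w 0 := by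
    simpa using ((Real.hasDerivAt_exp 0).mul_const w)
  have lk : HasDerivAt (fun t : ℝ => c * ((Real.exp t : ℂ) * ζ) + d) (c * ζ) 0 :=
    (lζ.const_mul c).add_const d
  have lm : HasDerivAt (fun t : ℝ => a * ((Real.exp t : ℂ) * ζ) + b) (a * ζ) 0 :=
    (lζ.const_mul a).add_const b
  have lΔ := (lk.mul (hasDerivAt_conj lk)).add ((lw.pow 2).const_mul (c * starRingEnd ℂ c))
  have ln := (lm.mul (hasDerivAt_conj lk)).add ((lw.pow 2).const_mul (a * starRingEnd ℂ c))
  have hΔc := hcx (c * ζ + d) c w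
  have hΔ0 : ((‖c * ζ + d‖ ^ 2 + ‖c‖ ^ 2 * w ^ 2 : ℝ) : ℂ) ≠ 0 := by exact_mod_cast hΔ.ne'
  have key := (ln.div lΔ (by
      simp only [Pi.add_apply, Pi.mul_apply, Pi.pow_apply, Real.exp_zero, Complex.ofReal_one,
        one_mul, ← hΔc]
      exact hΔ0)).prodMk
    ((lwr.const_mul ‖a * d - b * c‖).div (hasDerivAt_re lΔ)
      (by
        simp only [Pi.add_apply, Pi.mul_apply, Pi.pow_apply, Real.exp_zero, Complex.ofReal_one,
          one_mul, ← hΔc, Complex.ofReal_re]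
        exact hΔ.ne'))
  simp only [hcx]
  simp only [hre]
  have hfun : ∀ t : ℝ, Real.exp t • ((ζ, w) : ℂ × ℝ) = ((Real.exp t : ℂ) * ζ, Real.exp t * w) :=
    fun t => by simp
  simp only [hfun]
  refine key.congr_deriv ?_
  set δ := a * d - b * c with hδd
  set Δ : ℝ := ‖c * ζ + d‖ ^ 2 + ‖c‖ ^ 2 * w ^ 2 with hΔd
  have hδ' : starRingEnd ℂ δ ≠ 0 := by simpa using hδ
  simp only [Pi.add_apply, Pi.mul_apply, Pi.pow_apply, killing, Real.exp_zero, Complex.ofReal_one,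
    one_mul, ← hΔc, Complex.ofReal_re]
  have hWc : (((‖δ‖ * w / Δ : ℝ) : ℂ)) ^ 2 = δ * starRingEnd ℂ δ * w ^ 2 / Δ ^ 2 := by
    push_cast; rw [div_pow, mul_pow, nsq]
  refine Prod.ext ?_ ?_
  · simp only [hWc, map_div₀, map_mul, map_add]
    simp only [map_mul, map_add] at hΔc
    field_simp
    rw [hΔc, hδd]
    push_cast
    ring
  · have e1 : -(a * d + b * c) / (2 * δ) + c * d / δ *
        (((a * ζ + b) * starRingEnd ℂ (c * ζ + d) + a * starRingEnd ℂ c * (w : ℂ) ^ 2) / Δ)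
        = (1 / 2 : ℝ) - d * starRingEnd ℂ (c * ζ + d) / Δ := by
      have : c * ((a * ζ + b) * starRingEnd ℂ (c * ζ + d) + a * starRingEnd ℂ c * (w : ℂ) ^ 2)
          = a * Δ - starRingEnd ℂ (c * ζ + d) * δ := by
        rw [hΔc, hδd]; ring
      field_simp
      push_cast
      linear_combination (2 * d) * this + (Δ : ℂ) * hδd
    simp only [e1]
    have hΔr := congrArg Complex.re hΔc
    rw [Complex.ofReal_re] at hΔr
    rw [Complex.sub_re, Complex.ofReal_re, Complex.div_ofReal_re]
    field_simp
    rw [hΔr]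
    simp [pow_two]
    ring

/-- With `𝒞 = b / d` and `𝒟 = a / c` one has `𝒞 - 𝒟 = -δ / (cd)`, and the quotient becomes linear in
the three matrix entries. In this form the infinite cases need no limit. -/
theorem IsTranslationKillingField.eq_killing {𝒞 𝒟 : OnePoint ℂ} {Y : ℂ × ℝ → ℂ × ℝ}
    (hY : IsTranslationKillingField 𝒞 𝒟 Y) :
    ∃ P Q R : ℂ, (∀ x ∈ halfSpace, Y x = killing P Q R x) ∧
      ∀ φ₀ φ₁ φ₂ : ℂ, fluxQuotient φ₀ φ₁ φ₂ 𝒞 𝒟 = 2 * φ₁ * P + φ₂ * R - φ₀ * Q := by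
  obtain ⟨Φ, ⟨P, h0, hinf, hΦ⟩, hd⟩ := hY
  refine ⟨-(P 0 0 * P 1 1 + P 0 1 * P 1 0) / (2 * (P 0 0 * P 1 1 - P 0 1 * P 1 0)),
    P 1 0 * P 1 1 / (P 0 0 * P 1 1 - P 0 1 * P 1 0),
    -(P 0 0 * P 0 1) / (P 0 0 * P 1 1 - P 0 1 * P 1 0), fun x hx => ?_, fun φ₀ φ₁ φ₂ => ?_⟩
  -- The flow is prescribed only at points of the form `poincareExtension P p`, so surjectivity is
  -- needed to know `Y` everywhere.
  · obtain ⟨p, hp, rfl⟩ := exists_poincareExtension_eq P hx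
    have h1 := hd 0 _ hx
    have e : (fun r => Φ r (poincareExtension P p)) =
        fun r => poincareExtension P (Real.exp r • p) := funext fun r => hΦ r p hp
    rw [e, hΦ 0 p hp, Real.exp_zero, one_smul] at h1
    exact h1.unique (poincareExtension_hasDerivAt P hp)
  · have hδ : P 0 0 * P 1 1 - P 0 1 * P 1 0 ≠ 0 := by
      rw [← Matrix.det_fin_two]; exact P.det_ne_zero
    rw [OnePoint.smul_some_eq_ite] at h0
    rw [OnePoint.smul_infty_eq_ite] at hinf
    simp only [mul_zero, zero_add] at h0
    generalize P 0 0 = a at *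
    generalize P 0 1 = b at *
    generalize P 1 0 = c at *
    generalize P 1 1 = d at *
    rw [← h0, ← hinf]
    -- `c = 0` means `𝒟 = ∞` and `d = 0` means `𝒞 = ∞`.
    by_cases hc : c = 0 <;> by_cases hd : d = 0
    · simp [hc, hd] at hδ
    · have ha : a ≠ 0 := by rintro rfl; simp [hc] at hδ
      rw [if_neg hd, if_pos hc]
      change -(φ₂ * (b / d) + φ₁) = _
      subst hc
      field_simp
      ring
    · have hb : b ≠ 0 := by rintro rfl; simp [hd] at hδ
      rw [if_pos hd, if_neg hc]
      change φ₂ * (a / c) + φ₁ = _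
      subst hd
      field_simp
      ring
    · rw [if_neg hd, if_neg hc]
      change (φ₂ * (b / d) * (a / c) + φ₁ * (b / d + a / c) + φ₀) / (b / d - a / c) = _
      have : b / d - a / c = -(a * d - b * c) / (c * d) := by field_simp; ring
      rw [this]
      field_simp
      ring

/-! ### Residues and winding -/

theorem mem_punctured_of_mem_closedBall {ρ r : ℝ} (hΩ : Metric.closedBall (0 : ℂ) ρ ⊆ Ω)
    (hr : 0 < r) {z : ℂ} (h1 : r ≤ ‖z‖) (h2 : ‖z‖ ≤ ρ) : z ∈ Ω \ {0} :=
  ⟨hΩ (by simpa using h2), by rintro rfl; simp at h1; linarith⟩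

/-- By Cauchy's theorem on annuli the circle integral is constant for small radii, so the limit
defining the residue is attained. -/
theorem circleIntegral_eq_residueAtZero (hO : IsOpen Ω) {g : ℂ → ℂ}
    (hg : DifferentiableOn ℂ g (Ω \ {0})) {ρ : ℝ} (hρ : 0 < ρ)
    (hΩ : Metric.closedBall (0 : ℂ) ρ ⊆ Ω) :
    ∮ z in C(0, ρ), g z = 2 * Real.pi * Complex.I * residueAtZero g := by
  have h2 : (2 * Real.pi * Complex.I : ℂ) ≠ 0 := by simp [Real.pi_ne_zero]
  have hlim : Tendsto (fun r : ℝ => (2 * Real.pi * Complex.I)⁻¹ * ∮ z in C(0, r), g z) (𝓝[>] 0)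
      (𝓝 ((2 * Real.pi * Complex.I)⁻¹ * ∮ z in C(0, ρ), g z)) := by
    refine tendsto_const_nhds.congr' ?_
    filter_upwards [Ioc_mem_nhdsGT hρ] with r hr
    congr 1
    refine Complex.circleIntegral_eq_of_differentiable_on_annulus_off_countable hr.1 hr.2
      countable_empty (fun z hz => ?_) (fun z hz => ?_)
    · refine (hg.differentiableAt ((isOpen_punctured hO).mem_nhds ?_)).continuousAt.continuousWithinAt
      exact mem_punctured_of_mem_closedBall hΩ hr.1 (by simpa using hz.2) (by simpa using hz.1)
    · refine hg.differentiableAt ((isOpen_punctured hO).mem_nhds ?_)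
      have h3 : ‖z‖ < ρ := by simpa using hz.1.1
      have h4 : r < ‖z‖ := by simpa using hz.1.2
      exact mem_punctured_of_mem_closedBall hΩ hr.1 h4.le h3.le
  rw [residueAtZero, hlim.limUnder_eq, mul_inv_cancel_left₀ h2]

theorem integral_circle_reversed (g : ℂ → ℂ) (ρ : ℝ) :
    ∫ τ in (-Real.pi)..Real.pi, g (ρ * Complex.exp (-(τ * Complex.I)))
        * (-(ρ * (Complex.I * Complex.exp (-(τ * Complex.I))))) = -∮ z in C(0, ρ), g z := by
  set G : ℝ → ℂ := fun θ => g (ρ * Complex.exp (θ * Complex.I))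
    * (ρ * (Complex.I * Complex.exp (θ * Complex.I))) with hG
  have h1 : ∀ τ : ℝ, g (ρ * Complex.exp (-(τ * Complex.I)))
      * (-(ρ * (Complex.I * Complex.exp (-(τ * Complex.I))))) = -G (-τ) := by
    intro τ; simp [hG]
  simp only [h1]
  have hper : Function.Periodic G (2 * Real.pi) := by
    intro θ
    have : ((θ + 2 * Real.pi : ℝ) : ℂ) * Complex.I = θ * Complex.I + 2 * Real.pi * Complex.I := by
      push_cast; ring
    simp only [hG, this, Complex.exp_periodic (θ * Complex.I)]
  rw [intervalIntegral.integral_neg, intervalIntegral.integral_comp_neg, neg_neg]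
  have h2 := hper.intervalIntegral_add_eq (-Real.pi) 0
  rw [show -Real.pi + 2 * Real.pi = Real.pi by ring, zero_add] at h2
  rw [h2, circleIntegral]
  congr 1
  refine intervalIntegral.integral_congr fun θ _ => ?_
  simp only [hG, deriv_circleMap, circleMap, smul_eq_mul, zero_add]
  ring

theorem hasDerivAt_circle_reversed (ρ t : ℝ) :
    HasDerivAt (fun s : ℝ => (ρ : ℂ) * Complex.exp (-(s * Complex.I)))
      (-(ρ * (Complex.I * Complex.exp (-(t * Complex.I))))) t := by
  have := (((Complex.ofRealCLM.hasDerivAt (x := t)).mul_const Complex.I).neg).cexp.const_mul (ρ : ℂ)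
  refine this.congr_deriv ?_
  simp
  ring_nf
  simp

/-- The integral of a holomorphic form along a curve which winds clockwise around the puncture. -/
theorem WindsAround.integral_eq (hO : IsOpen Ω) {g : ℂ → ℂ}
    (hg : DifferentiableOn ℂ g (Ω \ {0})) {γ : ℝ → ℂ} (h : WindsAround Ω (-1) γ) :
    ∫ τ in (-Real.pi)..Real.pi, g (γ τ) * deriv γ τ =
      -(2 * Real.pi * Complex.I * residueAtZero g) := by
  obtain ⟨ρ, hρ, hΩ, H, hH, hper, hm, h0, h1⟩ := h
  rw [← circleIntegral_eq_residueAtZero hO hg hρ hΩ, ← integral_circle_reversed]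
  have hO' := isOpen_punctured hO
  set T : ℂ →L[ℝ] ℂ →L[ℝ] ℂ := ContinuousLinearMap.mul ℝ ℂ with hT
  have hgc : ContDiffOn ℝ 1 g (Ω \ {0}) := ((hg.analyticOn hO').contDiffOn hO'.uniqueDiffOn).restrict_scalars ℝ
  have hβ : ContDiffOn ℝ 1 (fun z => T (g z)) (Ω \ {0}) := T.contDiff.comp_contDiffOn hgc
  -- The derivative of `g dz` is symmetric in `U` and `V`, so the form is closed and the homotopy
  -- contributes nothing.
  have hdβ : ∀ z ∈ Ω \ {0}, ∀ U V : ℂ,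
      fderiv ℝ (fun z => T (g z)) z U V = deriv g z * U * V := by
    intro z hz U V
    have h3 := ((hg.differentiableAt (hO'.mem_nhds hz)).hasDerivAt.hasFDerivAt).restrictScalars ℝ
    change fderiv ℝ (T ∘ g) z U V = _
    rw [(T.hasFDerivAt.comp z h3).fderiv]
    simp [hT]
    ring_nf
    simp
  have key := integral_cylinder hH hper hO' hβ (fun r hr τ => hm r hr τ)
  rw [setIntegral_congr_fun measurableSet_Icc (g := fun _ => (0 : ℂ))
    (fun x hx => by
      have hx' := hm x.1 ⟨hx.1.1, hx.2.1⟩ x.2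
      simp only
      rw [hdβ _ hx', hdβ _ hx']; ring), integral_zero] at key
  have hHt : ∀ r t : ℝ, HasDerivAt (fun s : ℝ => H (r, s)) (fderiv ℝ H (r, t) (0, 1)) t := by
    intro r t
    exact (hH.differentiable (by simp) _).hasFDerivAt.comp_hasDerivAt t
      ((hasDerivAt_const t r).prodMk (hasDerivAt_id t))
  have hγ : (fun s : ℝ => H (0, s)) = γ := funext h0
  have e0 : ∀ t, fderiv ℝ H (0, t) (0, 1) = deriv γ t := fun t => by rw [← (hHt 0 t).deriv, hγ]
  have hc : (fun s : ℝ => H (1, s)) = fun s : ℝ => (ρ : ℂ) * Complex.exp (-(s * Complex.I)) := by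
    funext s; rw [h1]; congr 2; push_cast; ring
  have e1 : ∀ t : ℝ, fderiv ℝ H (1, t) (0, 1) =
      -(ρ * (Complex.I * Complex.exp (-(t * Complex.I)))) := fun t => by
    rw [← (hHt 1 t).deriv, hc]; exact (hasDerivAt_circle_reversed ρ t).deriv
  have e1' : ∀ t : ℝ, H (1, t) = (ρ : ℂ) * Complex.exp (-(t * Complex.I)) := fun t => congrFun hc t
  simp only [e0, e1, e1', h0, hT, ContinuousLinearMap.mul_apply'] at key
  exact (sub_eq_zero.1 key.symm).symm

/-! ### Evaluation of the flux -/

/-- Value of the flux in terms of the Killing parameters. -/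
theorem IsEndData.fluxValue_eq (h : IsEndData Ω X f₀ f₁ f₂) {P Q R : ℂ} {Y : ℂ × ℝ → ℂ × ℝ}
    (hY : ∀ x ∈ halfSpace, Y x = killing P Q R x) {γ : ℝ → ℂ} {η : ℝ → ℂ × ℝ} {K : ℂ → ℂ × ℝ}
    (hd : IsFluxData Ω X γ η K) :
    fluxValue X Y γ η K = (4 * Real.pi *
      residueAtZero (fun z => 2 * f₁ z * P + f₂ z * R - f₀ z * Q)).re := by
  obtain ⟨hw, hη⟩ := h.conormal_eq hd
  set g : ℂ → ℂ := fun z => 2 * f₁ z * P + f₂ z * R - f₀ z * Q with hg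
  have hgd : DifferentiableOn ℂ g (Ω \ {0}) :=
    (((h.holo₁.const_mul 2).mul_const P).add (h.holo₂.mul_const R)).sub (h.holo₀.mul_const Q)
  have hγ : ∀ τ, DifferentiableAt ℝ γ τ := hd.contDiff_curve.differentiable (by simp)
  have hvel : ∀ τ, velocity X γ τ = fderiv ℝ X (γ τ) (deriv γ τ) := fun τ =>
    hasDerivAt_comp_curve (h.differentiableAt (hw.mem τ)) (hγ τ)
  have hfirst : ∀ τ, hypInner (X (γ τ)) (η τ) (Y (X (γ τ))) * hypNorm (X (γ τ)) (velocity X γ τ) =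
      -2 * (g (γ τ) * deriv γ τ).im - fluxForm P Q R (X (γ τ)) (velocity X γ τ) := by
    intro τ
    have hz := hw.mem τ
    rw [mul_comm, ← hypInner_smul_left, hη, hY _ (h.mem _ hz), ← neg_one_smul ℝ,
      hypInner_smul_left, hvel, (h.hasFDerivAt _ hz).fderiv,
      hypInner_killingL_I_mul _ _ _ _ _ _ (h.mem _ hz)]
    have : deriv γ τ * (2 * -f₁ (γ τ) * P + -f₂ (γ τ) * R + f₀ (γ τ) * Q) =
        -(g (γ τ) * deriv γ τ) := by rw [hg]; ring
    rw [this, Complex.neg_im]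
    ring
  have hbd : (fun τ : ℝ => K (Complex.exp (τ * Complex.I))) = fun τ => X (γ τ) :=
    funext hd.boundary
  have hdisk := integral_disk P Q R hd.contDiff_disk hd.disk_mem
  rw [hbd] at hdisk
  simp only [hd.boundary] at hdisk
  have hdisk' : ∫ z in Metric.closedBall (0 : ℂ) 1,
        hypInner (K z) (diskNormal K z) (Y (K z)) * hypNorm (K z) (diskCross K z) =
      ∫ z in Metric.closedBall (0 : ℂ) 1,
        hypVol (K z) (fderiv ℝ K z 1) (fderiv ℝ K z Complex.I) (killing P Q R (K z)) := by
    refine setIntegral_congr_fun Metric.isClosed_closedBall.measurableSet fun z hz => ?_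
    rw [diskNormal_smul K (hd.disk_mem z hz), hY _ (hd.disk_mem z hz)]
  have hγc : Continuous γ := hd.contDiff_curve.continuous
  have hγ'c : Continuous (deriv γ) := hd.contDiff_curve.continuous_deriv (by simp)
  have hgc : Continuous (fun τ => g (γ τ) * deriv γ τ) := by
    refine Continuous.mul ?_ hγ'c
    exact hgd.continuousOn.comp_continuous hγc hw.mem
  have hXγ : ContDiff ℝ 1 (fun τ => X (γ τ)) := contDiff_iff_contDiffAt.2 fun τ =>
    (h.contDiffAt _ (hw.mem τ) 1).comp τ (hd.contDiff_curve.contDiffAt.of_le (by norm_num))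
  have hvc : Continuous (velocity X γ) := hXγ.continuous_deriv le_rfl
  have hfc : Continuous (fun τ => fluxForm P Q R (X (γ τ)) (velocity X γ τ)) := by
    simp only [← fluxFormL_apply]
    exact ((contDiffOn_fluxFormL P Q R).continuousOn.comp_continuous hXγ.continuous
      (fun τ => h.mem _ (hw.mem τ))).clm_apply hvc
  have hper : Function.Periodic (fun τ =>
      -2 * (g (γ τ) * deriv γ τ).im - fluxForm P Q R (X (γ τ)) (velocity X γ τ))
      (2 * Real.pi) := by
    intro τ
    have e1 : deriv γ (τ + 2 * Real.pi) = deriv γ τ := by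
      rw [← deriv_comp_add_const]; congr 1; exact funext hd.periodic
    have e2 : velocity X γ (τ + 2 * Real.pi) = velocity X γ τ := by
      rw [hvel, hvel, e1, hd.periodic]
    simp only [e1, e2, hd.periodic]
  rw [fluxValue, hdisk']
  simp only [hfirst]
  -- The flux is integrated over `[0, 2π]`, Stokes over `[-π, π]`; periodicity identifies the two.
  have h2 := hper.intervalIntegral_add_eq 0 (-Real.pi)
  rw [show -Real.pi + 2 * Real.pi = Real.pi by ring, zero_add] at h2
  rw [h2, intervalIntegral.integral_sub, intervalIntegral.integral_const_mul]
  · have him : ∫ τ in (-Real.pi)..Real.pi, (g (γ τ) * deriv γ τ).im =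
        (∫ τ in (-Real.pi)..Real.pi, g (γ τ) * deriv γ τ).im :=
      Complex.imCLM.intervalIntegral_comp_comm (hgc.intervalIntegrable _ _)
    rw [him, hw.integral_eq h.isOpen hgd]
    have : (4 * Real.pi * residueAtZero g : ℂ).re =
        2 * (2 * Real.pi * Complex.I * residueAtZero g).im := by
      simp; ring
    rw [this, Complex.neg_im]
    change _ = ∫ τ in (-Real.pi)..Real.pi, fluxForm P Q R (X (γ τ)) (velocity X γ τ) at hdisk
    -- The two integrals of `fluxForm` along the boundary cancel here.
    linear_combination hdisk
  · exact ((Complex.continuous_im.comp hgc).const_mul _).intervalIntegrable _ _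
  · exact hfc.intervalIntegrable _ _

theorem IsEndData.residue_combination (h : IsEndData Ω X f₀ f₁ f₂) (P Q R : ℂ) :
    residueAtZero (fun z => 2 * f₁ z * P + f₂ z * R - f₀ z * Q) =
      2 * residueAtZero f₁ * P + residueAtZero f₂ * R - residueAtZero f₀ * Q := by
  obtain ⟨ρ, hρ, hb⟩ := Metric.nhds_basis_closedBall.mem_iff.1 (h.isOpen.mem_nhds h.zero_mem)
  have hO := h.isOpen
  have h2 : (2 * Real.pi * Complex.I : ℂ) ≠ 0 := by simp [Real.pi_ne_zero]
  have ci : ∀ {f : ℂ → ℂ}, DifferentiableOn ℂ f (Ω \ {0}) → CircleIntegrable f 0 ρ := by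
    intro f hf
    refine ContinuousOn.circleIntegrable hρ.le (hf.continuousOn.mono fun z hz => ?_)
    have : ‖z‖ = ρ := by simpa using hz
    exact mem_punctured_of_mem_closedBall hb hρ this.ge this.le
  have d1 := (h.holo₁.const_mul 2).mul_const P
  have d2 := h.holo₂.mul_const R
  have d3 := h.holo₀.mul_const Q
  apply mul_left_cancel₀ h2
  rw [← circleIntegral_eq_residueAtZero (g := fun z => 2 * f₁ z * P + f₂ z * R - f₀ z * Q) hO
    ((d1.add d2).sub d3) hρ hb]
  have e : ∮ z in C(0, ρ), (2 * f₁ z * P + f₂ z * R - f₀ z * Q) =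
      2 * P * (∮ z in C(0, ρ), f₁ z) + R * (∮ z in C(0, ρ), f₂ z)
        - Q * (∮ z in C(0, ρ), f₀ z) := by
    rw [circleIntegral.integral_sub (f := fun z => 2 * f₁ z * P + f₂ z * R)
      (ci (d1.add d2)) (ci d3),
      circleIntegral.integral_add (ci d1) (ci d2), ← circleIntegral.integral_const_mul,
      ← circleIntegral.integral_const_mul, ← circleIntegral.integral_const_mul]
    congr 1
    · congr 1 <;> congr 1 <;> funext z <;> ring
    · congr 1; funext z; ring
  refine e.trans ?_
  rw [circleIntegral_eq_residueAtZero hO h.holo₀ hρ hb,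
    circleIntegral_eq_residueAtZero hO h.holo₁ hρ hb,
    circleIntegral_eq_residueAtZero hO h.holo₂ hρ hb]
  ring

/-! ### Existence of admissible curves and disks -/

/-- Radial extension of a map of the circle to a disk. -/
theorem exists_disk {c : ℂ → ℂ × ℝ} (hc : ∀ z : ℂ, z ≠ 0 → ContDiffAt ℝ 2 c z)
    (hm : ∀ z : ℂ, z ≠ 0 → c z ∈ halfSpace) :
    ∃ K : ℂ → ℂ × ℝ, ContDiff ℝ 2 K ∧ (∀ z, K z ∈ halfSpace) ∧ ∀ z, ‖z‖ = 1 → K z = c z := by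
  -- The half-space is convex, so interpolating between `c` and any of its points stays inside. The
  -- cutoff vanishes near `0`, where `c` may be singular, and equals `1` on the unit circle.
  set p : ℂ × ℝ := (0, 1)
  refine ⟨fun z => p + Real.smoothTransition (2 * ‖z‖ ^ 2 - 1) • (c z - p), ?_, ?_, ?_⟩
  · refine contDiff_iff_contDiffAt.2 fun z => ?_
    by_cases hz : z = 0
    · have : (fun z : ℂ => p + Real.smoothTransition (2 * ‖z‖ ^ 2 - 1) • (c z - p)) =ᶠ[𝓝 z]
          fun _ => p := by
        rw [hz]
        filter_upwards [Metric.ball_mem_nhds (0 : ℂ) (by norm_num : (0 : ℝ) < 1 / 2)] with y hy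
        have hy' : ‖y‖ < 1 / 2 := by simpa using hy
        rw [Real.smoothTransition.zero_of_nonpos (by nlinarith [norm_nonneg y])]
        simp
      exact contDiffAt_const.congr_of_eventuallyEq this
    · have h1 : ContDiff ℝ 2 fun z : ℂ => Real.smoothTransition (2 * ‖z‖ ^ 2 - 1) :=
        Real.smoothTransition.contDiff.comp
          ((contDiff_const.mul (contDiff_norm_sq ℝ)).sub contDiff_const)
      exact contDiffAt_const.add (h1.contDiffAt.smul ((hc z hz).sub contDiffAt_const))
  · intro z
    beta_reduce
    by_cases hz : z = 0
    · rw [hz, Real.smoothTransition.zero_of_nonpos (by norm_num)]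
      simp [halfSpace, p]
    · have h1 : 0 < (c z).2 := hm z hz
      have h2 := Real.smoothTransition.nonneg (2 * ‖z‖ ^ 2 - 1)
      have h3 := Real.smoothTransition.le_one (2 * ‖z‖ ^ 2 - 1)
      generalize Real.smoothTransition (2 * ‖z‖ ^ 2 - 1) = t at *
      change 0 < 1 + t * ((c z).2 - 1)
      rcases h2.eq_or_lt with rfl | h2
      · simp
      · nlinarith [mul_pos h2 h1]
  · intro z hz
    simp only
    rw [hz, Real.smoothTransition.one_of_one_le (by norm_num), one_smul]
    abel

theorem IsEndData.exists_fluxData (h : IsEndData Ω X f₀ f₁ f₂) :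
    ∃ γ η K, IsFluxData Ω X γ η K := by
  obtain ⟨ρ, hρ, hb⟩ := Metric.nhds_basis_closedBall.mem_iff.1 (h.isOpen.mem_nhds h.zero_mem)
  -- Clockwise, as the orientation condition requires.
  set γ : ℝ → ℂ := fun τ => ρ * Complex.exp (-(τ * Complex.I)) with hγd
  have hnorm : ∀ τ, ‖γ τ‖ = ρ := fun τ => by
    have : -((τ : ℂ) * Complex.I) = ((-τ : ℝ) : ℂ) * Complex.I := by push_cast; ring
    rw [hγd]
    simp only
    rw [norm_mul, this, Complex.norm_exp_ofReal_mul_I]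
    simp [abs_of_pos hρ]
  have hmem : ∀ τ, γ τ ∈ Ω \ {0} := fun τ =>
    mem_punctured_of_mem_closedBall hb hρ (hnorm τ).ge (hnorm τ).le
  have hγc : ContDiff ℝ 2 γ :=
    contDiff_const.mul (Complex.ofRealCLM.contDiff.mul contDiff_const).neg.cexp
  have hper : ∀ τ, γ (τ + 2 * Real.pi) = γ τ := fun τ => by
    simp only [hγd]
    congr 1
    rw [show -(((τ + 2 * Real.pi : ℝ) : ℂ) * Complex.I)
      = -(τ * Complex.I) - 2 * Real.pi * Complex.I by push_cast; ring,
      Complex.exp_periodic.sub_eq]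
  have hγ' : ∀ τ, HasDerivAt γ (-(Complex.I * γ τ)) τ := fun τ => by
    refine (hasDerivAt_circle_reversed ρ τ).congr_deriv ?_
    rw [hγd]
    ring
  have hreg : ∀ τ, deriv γ τ ≠ 0 := fun τ => by
    rw [(hγ' τ).deriv]
    exact neg_ne_zero.2 (mul_ne_zero Complex.I_ne_zero (hmem τ).2)
  have hvel : ∀ τ, velocity X γ τ = fderiv ℝ X (γ τ) (deriv γ τ) := fun τ =>
    hasDerivAt_comp_curve (h.differentiableAt (hmem τ)) (hγ' τ).differentiableAt
  have hl := fun τ => h.firstForm_pos (hmem τ)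
  have hn0 : ∀ τ, 0 < ‖deriv γ τ‖ := fun τ => norm_pos_iff.2 (hreg τ)
  set a : ℝ → ℝ := fun τ => (‖deriv γ τ‖ * Real.sqrt (firstForm X (γ τ) 1 1))⁻¹ with ha
  have hapos : ∀ τ, 0 < a τ := fun τ => inv_pos.2 (mul_pos (hn0 τ) (Real.sqrt_pos.2 (hl τ)))
  -- The right-hand normal of `γ`, scaled by `a` so that its image under `dX` has length one.
  set v : ℝ → ℂ := fun τ => (a τ : ℂ) * -(Complex.I * deriv γ τ) with hv
  have hvu : ∀ τ, starRingEnd ℂ (deriv γ τ) * v τ =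
      ((-(a τ * ‖deriv γ τ‖ ^ 2) : ℝ) : ℂ) * Complex.I := fun τ => by
    push_cast
    rw [← Complex.conj_mul', hv]
    ring
  have hneg : ∀ τ, (starRingEnd ℂ (deriv γ τ) * v τ).im < 0 := fun τ => by
    rw [hvu, Complex.im_ofReal_mul, Complex.I_im, mul_one, neg_lt_zero]
    exact mul_pos (hapos τ) (pow_pos (hn0 τ) 2)
  -- The conjugate reverses the circle: `exp(iτ)` is sent to `γ τ`.
  obtain ⟨K, hK, hKm, hKc⟩ := exists_disk
    (c := fun z => X (ρ * (starRingEnd ℂ z / (‖z‖ : ℂ)))) (fun z hz => by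
      have hz' : (‖z‖ : ℂ) ≠ 0 := by simpa using hz
      have h1 : ρ * (starRingEnd ℂ z / (‖z‖ : ℂ)) ∈ Ω \ {0} := by
        have : ‖(ρ : ℂ) * (starRingEnd ℂ z / (‖z‖ : ℂ))‖ = ρ := by
          have hz2 : ‖z‖ ≠ 0 := by simpa using hz
          simp [abs_of_pos hρ, hz2]
        exact mem_punctured_of_mem_closedBall hb hρ this.ge this.le
      refine (h.contDiffAt _ h1 2).comp z (contDiffAt_const.mul ?_)
      simp only [div_eq_mul_inv]
      refine ContDiffAt.mul (Complex.conjCLE : ℂ →L[ℝ] ℂ).contDiff.contDiffAt (ContDiffAt.inv ?_ hz')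
      exact Complex.ofRealCLM.contDiff.contDiffAt.comp z (contDiffAt_norm ℝ hz))
    (fun z hz => by
      refine h.mem _ ?_
      have : ‖(ρ : ℂ) * (starRingEnd ℂ z / (‖z‖ : ℂ))‖ = ρ := by
        have hz2 : ‖z‖ ≠ 0 := by simpa using hz
        simp [abs_of_pos hρ, hz2]
      exact mem_punctured_of_mem_closedBall hb hρ this.ge this.le)
  refine ⟨γ, fun τ => fderiv ℝ X (γ τ) (v τ), K, ⟨hγc, hper, hreg, ⟨-1, Or.inr rfl, ?_, ?_⟩, ?_,
    hK, fun z _ => hKm z, ?_⟩⟩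
  · refine ⟨ρ, hρ, hb, fun x => γ x.2, hγc.comp contDiff_snd, fun r τ => hper τ,
      fun r _ τ => hmem τ, fun τ => rfl, fun τ => ?_⟩
    simp [hγd]
  · intro τ
    refine ⟨v τ, ?_, rfl, ?_, ?_⟩
    · have := hneg τ
      push_cast
      linarith
    · rw [hvel, h.conformal (hmem τ)]
      have : (starRingEnd ℂ (v τ) * deriv γ τ).re = (starRingEnd ℂ (deriv γ τ) * v τ).re := by
        simp; ring
      rw [this, hvu, Complex.re_ofReal_mul, Complex.I_re]
      simp
    · rw [h.conformal (hmem τ), Complex.conj_mul', ← Complex.ofReal_pow, Complex.ofReal_re]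
      have : ‖v τ‖ = a τ * ‖deriv γ τ‖ := by
        simp only [hv]
        simp [abs_of_pos (hapos τ)]
      rw [this, ha]
      have h1 := Real.sq_sqrt (hl τ).le
      have h2 := (Real.sqrt_pos.2 (hl τ)).ne'
      have h3 := (hn0 τ).ne'
      field_simp
      exact h1.symm
  · intro τ
    obtain ⟨c, hc, e⟩ := h.hypVol_meanCurvatureVector (hmem τ)
    rw [hvel, e, neg_pos]
    exact mul_neg_of_pos_of_neg hc (hneg τ)
  · intro τ
    have hn : ‖Complex.exp (τ * Complex.I)‖ = 1 := Complex.norm_exp_ofReal_mul_I τ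
    rw [hKc _ hn, hn]
    simp only [hγd, Complex.ofReal_one, div_one, ← Complex.exp_conj]
    simp

end BryantFlux

theorem theorem3p1 (Ω : Set ℂ) (A B C D : ℂ → ℂ) (X : ℂ → ℂ × ℝ)
    (hE : BryantFlux.IsBryantEnd Ω (fun s => !![A s, B s; C s, D s]) X) :
    ∃ f₀ f₁ f₂ : ℂ → ℂ,
      BryantFlux.IsPullback Ω (fun s => D s * deriv C s - C s * deriv D s) f₀ ∧
      BryantFlux.IsPullback Ω (fun s => C s * deriv B s - D s * deriv A s) f₁ ∧
      BryantFlux.IsPullback Ω (fun s => B s * deriv A s - A s * deriv B s) f₂ ∧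
      ∀ 𝒞 𝒟 : OnePoint ℂ, 𝒞 ≠ 𝒟 →
        ∀ Y : ℂ × ℝ → ℂ × ℝ, BryantFlux.IsTranslationKillingField 𝒞 𝒟 Y →
          BryantFlux.IsFlux Ω X Y
            (BryantFlux.fluxQuotient
              (4 * Real.pi * BryantFlux.residueAtZero f₀)
              (4 * Real.pi * BryantFlux.residueAtZero f₁)
              (4 * Real.pi * BryantFlux.residueAtZero f₂) 𝒞 𝒟).re := by
  obtain ⟨f₀, f₁, f₂, h, h₀, h₁, h₂⟩ := hE.exists_endData
  refine ⟨f₀, f₁, f₂, h₀, h₁, h₂, fun 𝒞 𝒟 _ Y hY => ⟨h.exists_fluxData, fun γ η K hd => ?_⟩⟩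
  obtain ⟨P, Q, R, hYk, hq⟩ := hY.eq_killing
  rw [h.fluxValue_eq hYk hd, h.residue_combination, hq]
  congr 1
  ring
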